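/- Let $H$ be a connected finite-dimensional Lie group with Lie algebra $\mathfrak h$, let $(P,\omega_P)$ be a connected finite-dimensional symplectic manifold on which $H$ acts smoothly by symplectic maps, and let $H$ act on $H\times P$ by $g\cdot(h,x)=(gh,g\cdot x)$, with infinitesimal generators $\xi_{H\times P}$, $\xi\in\mathfrak h$. Let $B$ be a closed two-form on $H\times P$ with $B|_P=-\omega_P$ that has a $B\mathfrak g$-potential, i.e. a smooth map $\phi:H\times P\to\mathfrak h^*$ with $\mathbf i_{\xi_{H\times P}}B=\mathbf d\langle\phi,\xi\rangle$ for all $\xi\in\mathfrak h$, and let $$\Sigma(\xi,\eta)=-\langle\phi,[\xi,\eta]\rangle+B(\xi_{H\times P},\eta_{H\times P})\in C^\infty(H\times P)$$ be its non-equivariance two-cocycle. On $\mathfrak h^*\times P$ consider the bracket $$\{f,k\}_\Sigma=\{f|_{\mathfrak h^*},k|_{\mathfrak h^*}\}_{\mathrm{l.p.}}-\{f|_P,k|_P\}_P-\Sigma\Big(\frac{\delta f}{\delta\mu},\frac{\delta k}{\delta\mu}\Big),$$ where $\{f,k\}_{\mathrm{l.p.}}(\mu)=-\langle\mu,[\frac{\delta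 f}{\delta\mu},\frac{\delta k}{\delta\mu}]\rangle$ is the Lie–Poisson bracket, $\{\cdot,\cdot\}_P$ is the Poisson bracket of $\omega_P$, and $\Sigma$ is evaluated at $(e,x)$. The symplectic leaf through a point is the set of all points that can be reached from it along a piecewise smooth curve each piece of which is a trajectory of a locally defined Hamiltonian vector field. If $\Sigma=0$, then the symplectic leaf of $\{\cdot,\cdot\}_{\Sigma=0}$ through $(\mu,x)$ is $\mathcal O_\mu\times P$, where $\mathcal O_\mu$ is the coadjoint orbit of $\mu$ under $H$; thus the symplectic leaves are exactly the products $\mathcal O_\mu\times P$, $\mu\in\mathfrak h^*$. For $H=\operatorname{SE}(2)$, with coordinates $(\Pi_x,\Pi_y,\Omega)$ on $\mathfrak{se}(2)^*\cong\mathbb R^3$ dual to the infinitesimal translations $\mathbf e_x,\mathbf e_y$ and the infinitesimal rotation $\mathbf e_\Omega$, the coadjoint orbits are exactly the cylinders $\{\Pi_x^2+\Pi_y^2=r\}$ with $r>0$ and the single points $(0,0,c)$, $c\in\mathbb R$, of the $\Omega$-axis. For $P=\mathbb R^{2N}$, $N\ge 0$, with $\omega_P=\sum_{i=1}^N\Gamma_i\,dx_i\wedge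 dy_i$ and arbitrary nonzero real vortex strengths $\Gamma_i$, the symplectic leaves of $\{\cdot,\cdot\}_{\Sigma=0}$ on $\mathfrak{se}(2)^*\times\mathbb R^{2N}$ are exactly the products of these cylinders and of these points with $\mathbb R^{2N}$. -/

import Mathlib

open Set
open scoped Manifold ContDiff

noncomputable section

namespace SymplecticLeaves

/-! ### Two-forms and symplectic forms on a manifold -/

section TwoForms

variable {E : Type*} [NormedAddCommGroup E] [NormedSpace ℝ E]
  {A : Type*} [TopologicalSpace A] (I : ModelWithCorners ℝ E A)
  (M : Type*) [TopologicalSpace M] [ChartedSpace A M] [IsManifold I ∞ M]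

/-- A smooth differential two-form on `M`. -/
structure TwoForm where
  toFun : ∀ x : M, TangentSpace I x →L[ℝ] TangentSpace I x →L[ℝ] ℝ
  alternating : ∀ (x : M) (v : TangentSpace I x), toFun x v v = 0
  smooth : ContMDiff I (I.prod 𝓘(ℝ, E →L[ℝ] E →L[ℝ] ℝ)) ∞
    (fun x : M => Bundle.TotalSpace.mk' (E →L[ℝ] E →L[ℝ] ℝ)
      (E := fun x : M => TangentSpace I x →L[ℝ] TangentSpace I x →L[ℝ] ℝ) x (toFun x))

variable {I M}

/-- The derivative `df(v)` of a function `f` in the direction of a tangent vector `v`. -/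
def dir (f : M → ℝ) (x : M) (v : TangentSpace I x) : ℝ := mfderiv I 𝓘(ℝ, ℝ) f x v

/-- `dΩ = 0`, where `dΩ(X, Y, Z) = X Ω(Y, Z) - Y Ω(X, Z) + Z Ω(X, Y)
- Ω([X, Y], Z) + Ω([X, Z], Y) - Ω([Y, Z], X)` for vector fields `X`, `Y`, `Z` that are smooth
near the point. -/
def TwoForm.IsClosed (Ω : TwoForm I M) : Prop :=
  ∀ (x : M) (X Y Z : ∀ y : M, TangentSpace I y),
    ContMDiffAt I I.tangent ∞ (fun y => (X y : TangentBundle I M)) x →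
    ContMDiffAt I I.tangent ∞ (fun y => (Y y : TangentBundle I M)) x →
    ContMDiffAt I I.tangent ∞ (fun y => (Z y : TangentBundle I M)) x →
    dir (fun y => Ω.toFun y (Y y) (Z y)) x (X x)
      - dir (fun y => Ω.toFun y (X y) (Z y)) x (Y x)
      + dir (fun y => Ω.toFun y (X y) (Y y)) x (Z x)
      - Ω.toFun x (VectorField.mlieBracket I X Y x) (Z x)
      + Ω.toFun x (VectorField.mlieBracket I X Z x) (Y x)
      - Ω.toFun x (VectorField.mlieBracket I Y Z x) (X x) = 0

variable (I M) in
/-- A symplectic form: a smooth, closed, nondegenerate two-form. -/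
structure SymplecticForm extends TwoForm I M where
  closed : toTwoForm.IsClosed
  nondegenerate : ∀ (x : M) (v : TangentSpace I x), (∀ w, toFun x v w = 0) → v = 0

variable [FiniteDimensional ℝ E]

/-- The isomorphism `T_x M ≃ T_x^* M`, `v ↦ Ω(v, ·)`. -/
def SymplecticForm.flat (Ω : SymplecticForm I M) (x : M) : E ≃ₗ[ℝ] (E →L[ℝ] ℝ) :=
  LinearMap.linearEquivOfInjective
    (V := E) (V₂ := E →L[ℝ] ℝ)
    (show E →L[ℝ] E →L[ℝ] ℝ from Ω.toFun x).toLinearMap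
    ((injective_iff_map_eq_zero _).2 fun v hv =>
      Ω.nondegenerate x v fun w => congrArg (fun α : E →L[ℝ] ℝ => α w) hv)
    (by
      rw [← (LinearMap.toContinuousLinearMap (𝕜 := ℝ) (E := E) (F' := ℝ)).finrank_eq]
      exact (Subspace.dual_finrank_eq (K := ℝ) (V := E)).symm)

/-- The vector `α^♯`, defined by `Ω(α^♯, ·) = α`. -/
def SymplecticForm.sharp (Ω : SymplecticForm I M) (x : M) (α : E →L[ℝ] ℝ) : TangentSpace I x :=
  (Ω.flat x).symm α

/-- The Poisson bracket of a symplectic manifold, `{f, k} = df((dk)^♯)`. -/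
def SymplecticForm.bracket (Ω : SymplecticForm I M) (f k : M → ℝ) (x : M) : ℝ :=
  dir f x (Ω.sharp x (mfderiv I 𝓘(ℝ, ℝ) k x))

end TwoForms

/-! ### Symplectic leaves of a Poisson bracket -/

section Leaves

variable {E : Type*} [NormedAddCommGroup E] [NormedSpace ℝ E]
  {A : Type*} [TopologicalSpace A] (I : ModelWithCorners ℝ E A)
  {M : Type*} [TopologicalSpace M] [ChartedSpace A M]

/-- `X` is on `U` the Hamiltonian vector field of `f` for the bracket `br`: `X(F) = {F, f}`. -/
def IsHamiltonianVectorField (br : (M → ℝ) → (M → ℝ) → M → ℝ) (f : M → ℝ) (U : Set M)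
    (X : ∀ p : M, TangentSpace I p) : Prop :=
  ∀ p ∈ U, ∀ F : M → ℝ, ContMDiffAt I 𝓘(ℝ, ℝ) ∞ F p →
    dir F p (X p) = br F f p

/-- `p` is joined to `q` by a trajectory of a locally defined Hamiltonian vector field. -/
def HamiltonianSegment (br : (M → ℝ) → (M → ℝ) → M → ℝ) (p q : M) : Prop :=
  ∃ (U : Set M) (f : M → ℝ) (X : ∀ p : M, TangentSpace I p) (γ : ℝ → M) (a b : ℝ),
    IsOpen U ∧ ContMDiffOn I 𝓘(ℝ, ℝ) ∞ f U ∧ IsHamiltonianVectorField I br f U X ∧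
    a ≤ b ∧ MapsTo γ (Icc a b) U ∧ IsMIntegralCurveOn γ X (Icc a b) ∧ γ a = p ∧ γ b = q

/-- The symplectic leaf through `p`: all points that can be reached from `p` along a piecewise
smooth curve, each piece of which is a trajectory of a locally defined Hamiltonian vector field. -/
def symplecticLeaf (br : (M → ℝ) → (M → ℝ) → M → ℝ) (p : M) : Set M :=
  {q | Relation.ReflTransGen (HamiltonianSegment I br) p q}

/-- The collection of all symplectic leaves. -/
def symplecticLeaves (br : (M → ℝ) → (M → ℝ) → M → ℝ) : Set (Set M) :=
  range (symplecticLeaf I br)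

end Leaves

/-! ### The dual of the Lie algebra of a Lie group

The Lie algebra `𝔥` is the tangent space at the identity, which Mathlib models on the vector
space `E`, with the bracket of left-invariant vector fields; its dual `𝔥*` is `E →L[ℝ] ℝ`. -/

section LieDual

variable {E : Type*} [NormedAddCommGroup E] [NormedSpace ℝ E]
  {A : Type*} [TopologicalSpace A] (I : ModelWithCorners ℝ E A)
  (H : Type*) [TopologicalSpace H] [ChartedSpace A H] [Group H]

/-- The Lie bracket of `𝔥`. -/
def lieBr (ξ η : E) : E :=
  Bracket.bracket (L := GroupLieAlgebra I H) (M := GroupLieAlgebra I H) ξ η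

variable {H}

/-- The adjoint action: `Ad_g` is the derivative at the identity of `h ↦ g h g⁻¹`. -/
def Ad (g : H) : E →L[ℝ] E := mfderiv I I (fun h : H => g * h * g⁻¹) 1

variable (H) in
/-- The coadjoint orbit `O_μ = {Ad_{g⁻¹}^* μ | g ∈ H}`. -/
def coadjointOrbit (μ : E →L[ℝ] ℝ) : Set (E →L[ℝ] ℝ) :=
  {ν | ∃ g : H, ν = μ.comp (Ad I g⁻¹)}

variable [FiniteDimensional ℝ E]

variable (E) in
/-- The canonical isomorphism `𝔥 ≃ 𝔥**`. -/
def bidual : E ≃ₗ[ℝ] ((E →L[ℝ] ℝ) →L[ℝ] ℝ) :=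
  LinearMap.linearEquivOfInjective (NormedSpace.inclusionInDoubleDual ℝ E).toLinearMap
    (NormedSpace.inclusionInDoubleDualLi ℝ (E := E)).injective
    (by
      rw [← (LinearMap.toContinuousLinearMap (𝕜 := ℝ) (E := E →L[ℝ] ℝ) (F' := ℝ)).finrank_eq,
        Subspace.dual_finrank_eq,
        ← (LinearMap.toContinuousLinearMap (𝕜 := ℝ) (E := E) (F' := ℝ)).finrank_eq,
        Subspace.dual_finrank_eq])

/-- The functional derivative `δf/δμ ∈ 𝔥`, defined by `Df(μ)(ν) = ⟨ν, δf/δμ⟩`. -/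
def funcDeriv (f : (E →L[ℝ] ℝ) → ℝ) (μ : E →L[ℝ] ℝ) : E :=
  (bidual E).symm (fderiv ℝ f μ)

variable (H) in
/-- The (minus) Lie-Poisson bracket `{f, k}(μ) = -⟨μ, [δf/δμ, δk/δμ]⟩` on `𝔥*`. -/
def liePoisson (f k : (E →L[ℝ] ℝ) → ℝ) (μ : E →L[ℝ] ℝ) : ℝ :=
  -μ (lieBr I H (funcDeriv f μ) (funcDeriv k μ))

end LieDual

/-! ### Coupling of a Lie group to a symplectic manifold -/

section Coupling

variable {E : Type*} [NormedAddCommGroup E] [NormedSpace ℝ E]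
  {A : Type*} [TopologicalSpace A] {I : ModelWithCorners ℝ E A}
  {H : Type*} [TopologicalSpace H] [ChartedSpace A H] [Group H]
  {F : Type*} [NormedAddCommGroup F] [NormedSpace ℝ F]
  {C : Type*} [TopologicalSpace C] {J : ModelWithCorners ℝ F C}
  {P : Type*} [TopologicalSpace P] [ChartedSpace C P]

variable (I J) in
/-- The infinitesimal generator `ξ_{H × P}` of the diagonal action `g · (h, x) = (g h, g x)`. -/
def generator [MulAction H P] (ξ : E) (p : H × P) : TangentSpace (I.prod J) p :=
  mfderiv I (I.prod J) (fun g : H => (g * p.1, g • p.2)) 1 ξ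

variable (H) in
/-- The data that couple `H` to the symplectic manifold `(P, Ω)`, on which `H` acts by
symplectic maps: a closed two-form `B` on `H × P` with `B|_P = -Ω`, and a `B𝔤`-potential
`φ : H × P → 𝔥*`, that is `i_{ξ_{H × P}} B = d⟨φ, ξ⟩` for all `ξ ∈ 𝔥`. -/
structure MagneticCoupling [LieGroup I ∞ H] [IsManifold J ∞ P] [MulAction H P]
    (Ω : SymplecticForm J P) where
  action_symplectic : ∀ (g : H) (x : P) (v w : TangentSpace J x),
    Ω.toFun (g • x) (mfderiv J J (fun y : P => g • y) x v) (mfderiv J J (fun y : P => g • y) x w)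
      = Ω.toFun x v w
  B : TwoForm (I.prod J) (H × P)
  B_closed : B.IsClosed
  B_restrict : ∀ (h : H) (x : P) (v w : F),
    B.toFun (h, x) ((0, v) : E × F) ((0, w) : E × F) = -Ω.toFun x v w
  φ : H × P → (E →L[ℝ] ℝ)
  φ_smooth : ContMDiff (I.prod J) 𝓘(ℝ, E →L[ℝ] ℝ) ∞ φ
  φ_potential : ∀ (ξ : E) (p : H × P) (v : TangentSpace (I.prod J) p),
    B.toFun p (generator I J ξ p) v = dir (fun q => φ q ξ) p v

/-- The non-equivariance two-cocycle
`Σ(ξ, η) = -⟨φ, [ξ, η]⟩ + B(ξ_{H × P}, η_{H × P})`, with values in functions on `H × P`. -/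
def MagneticCoupling.cocycle [LieGroup I ∞ H] [IsManifold J ∞ P] [MulAction H P]
    {Ω : SymplecticForm J P} (D : MagneticCoupling (I := I) H Ω) (ξ η : E) (p : H × P) : ℝ :=
  -D.φ p (lieBr I H ξ η) + D.B.toFun p (generator I J ξ p) (generator I J η p)

variable (I H) in
/-- The natural bracket
`{f, k}_Σ = {f|_{𝔥*}, k|_{𝔥*}}_{l.p.} - {f|_P, k|_P}_P - Σ(δf/δμ, δk/δμ)` on `𝔥* × P`, where the
values of `Σ` are regarded as functions on `P` by restriction to `{e} × P`. -/
def naturalBracket [FiniteDimensional ℝ E] [FiniteDimensional ℝ F] [IsManifold J ∞ P]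
    (Ω : SymplecticForm J P) (S : E → E → H × P → ℝ)
    (f k : (E →L[ℝ] ℝ) × P → ℝ) (z : (E →L[ℝ] ℝ) × P) : ℝ :=
  liePoisson I H (fun μ => f (μ, z.2)) (fun μ => k (μ, z.2)) z.1
    - Ω.bracket (fun x => f (z.1, x)) (fun x => k (z.1, x)) z.2
    - S (funcDeriv (fun μ => f (μ, z.2)) z.1) (funcDeriv (fun μ => k (μ, z.2)) z.1) (1, z.2)

end Coupling

/-! ### The Euclidean group of the plane -/

section Euclidean

/-- The group `SE(2)` of pairs `(R, x₀)` of a rotation and a translation of the plane `ℝ² = ℂ`,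
with `(R, x₀) (R', x₀') = (R R', R x₀' + x₀)`. -/
def SE2 : Type := Circle × ℂ

namespace SE2

instance : TopologicalSpace SE2 := inferInstanceAs (TopologicalSpace (Circle × ℂ))

instance : ChartedSpace (ModelProd (EuclideanSpace ℝ (Fin 1)) ℂ) SE2 :=
  inferInstanceAs (ChartedSpace (ModelProd (EuclideanSpace ℝ (Fin 1)) ℂ) (Circle × ℂ))

/-- The model space of `SE(2)`, and so the vector space that underlies `𝔰𝔢(2)`. -/
abbrev Model : Type := EuclideanSpace ℝ (Fin 1) × ℂ

/-- The model with corners of `SE(2)`, as the product manifold `S¹ × ℝ²`. -/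
abbrev 𝓘SE : ModelWithCorners ℝ Model (ModelProd (EuclideanSpace ℝ (Fin 1)) ℂ) :=
  (𝓡 1).prod 𝓘(ℝ, ℂ)

instance : Group SE2 where
  mul g h := (g.1 * h.1, (g.1 : ℂ) * h.2 + g.2)
  one := (1, 0)
  inv g := (g.1⁻¹, -(((g.1⁻¹ : Circle) : ℂ) * g.2))
  mul_assoc a b c := Prod.ext (mul_assoc _ _ _) (by
    change ((a.1 * b.1 : Circle) : ℂ) * c.2 + (a.1 * b.2 + a.2)
      = a.1 * (b.1 * c.2 + b.2) + a.2
    push_cast; ring)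
  one_mul a := Prod.ext (one_mul _) (by
    change ((1 : Circle) : ℂ) * a.2 + 0 = a.2
    simp)
  mul_one a := Prod.ext (mul_one _) (by
    change (a.1 : ℂ) * 0 + a.2 = a.2
    simp)
  inv_mul_cancel a := Prod.ext (inv_mul_cancel _) (by
    change ((a.1⁻¹ : Circle) : ℂ) * a.2 + -(((a.1⁻¹ : Circle) : ℂ) * a.2) = 0
    simp)

theorem contMDiff_coe : ContMDiff (𝓡 1) 𝓘(ℝ, ℂ) ∞ (fun z : Circle => (z : ℂ)) :=
  haveI : Fact (Module.finrank ℝ ℂ = 1 + 1) := finrank_real_complex_fact'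
  contMDiff_coe_sphere

theorem contMDiff_cmul {G : Type*} [NormedAddCommGroup G] [NormedSpace ℝ G]
    {K : Type*} [TopologicalSpace K] {I : ModelWithCorners ℝ G K}
    {M : Type*} [TopologicalSpace M] [ChartedSpace K M] {f g : M → ℂ}
    (hf : ContMDiff I 𝓘(ℝ, ℂ) ∞ f) (hg : ContMDiff I 𝓘(ℝ, ℂ) ∞ g) :
    ContMDiff I 𝓘(ℝ, ℂ) ∞ (fun x => f x * g x) :=
  ((ContinuousLinearMap.mul ℝ ℂ).contMDiff.comp hf).clm_apply hg

instance : LieGroup 𝓘SE ∞ SE2 where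
  toIsManifold := inferInstanceAs (IsManifold 𝓘SE ∞ (Circle × ℂ))
  contMDiff_mul := by
    have h : ContMDiff (𝓘SE.prod 𝓘SE) 𝓘SE ∞
        (fun p : (Circle × ℂ) × (Circle × ℂ) =>
          ((p.1.1 * p.2.1, (p.1.1 : ℂ) * p.2.2 + p.1.2) : Circle × ℂ)) := by
      have a : ContMDiff (𝓘SE.prod 𝓘SE) (𝓡 1) ∞
          (fun p : (Circle × ℂ) × (Circle × ℂ) => p.1.1) := contMDiff_fst.comp contMDiff_fst
      have b : ContMDiff (𝓘SE.prod 𝓘SE) (𝓡 1) ∞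
          (fun p : (Circle × ℂ) × (Circle × ℂ) => p.2.1) := contMDiff_fst.comp contMDiff_snd
      have c : ContMDiff (𝓘SE.prod 𝓘SE) 𝓘(ℝ, ℂ) ∞
          (fun p : (Circle × ℂ) × (Circle × ℂ) => p.1.2) := contMDiff_snd.comp contMDiff_fst
      have d : ContMDiff (𝓘SE.prod 𝓘SE) 𝓘(ℝ, ℂ) ∞
          (fun p : (Circle × ℂ) × (Circle × ℂ) => p.2.2) := contMDiff_snd.comp contMDiff_snd
      exact (a.mul b).prodMk ((contMDiff_cmul (contMDiff_coe.comp a) d).add c)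
    exact h
  contMDiff_inv := by
    have h : ContMDiff 𝓘SE 𝓘SE ∞
        (fun p : Circle × ℂ => ((p.1⁻¹, -(((p.1⁻¹ : Circle) : ℂ) * p.2)) : Circle × ℂ)) := by
      have a : ContMDiff 𝓘SE (𝓡 1) ∞ (fun p : Circle × ℂ => p.1⁻¹) := contMDiff_fst.inv
      exact a.prodMk (contMDiff_cmul (contMDiff_coe.comp a) contMDiff_snd).neg
    exact h

/-- `e_Ω`, the velocity at `t = 0` of the rotations `t ↦ (e^{it}, 0)`. -/
def eΩ : Model := mfderiv 𝓘(ℝ, ℝ) 𝓘SE (fun t : ℝ => ((Circle.exp t, 0) : SE2)) 0 (1 : ℝ)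

/-- `e_x`, the velocity at `t = 0` of the translations `t ↦ (1, t)`. -/
def ex : Model := mfderiv 𝓘(ℝ, ℝ) 𝓘SE (fun t : ℝ => ((1, (t : ℂ)) : SE2)) 0 (1 : ℝ)

/-- `e_y`, the velocity at `t = 0` of the translations `t ↦ (1, it)`. -/
def ey : Model := mfderiv 𝓘(ℝ, ℝ) 𝓘SE (fun t : ℝ => ((1, (t : ℂ) * Complex.I) : SE2)) 0 (1 : ℝ)

/-- For a constant `r`, the cylinder `Π_x² + Π_y² = r` in `𝔰𝔢(2)*`, where
`(Π_x, Π_y, Π_Ω) = (⟨Π, e_x⟩, ⟨Π, e_y⟩, ⟨Π, e_Ω⟩)`. -/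
def cylinder (r : ℝ) : Set (Model →L[ℝ] ℝ) := {ν | ν ex ^ 2 + ν ey ^ 2 = r}

/-- The point `(0, 0, c)` of the `Ω`-axis, as a subset of `𝔰𝔢(2)*`. -/
def axisPoint (c : ℝ) : Set (Model →L[ℝ] ℝ) := {ν | ν ex = 0 ∧ ν ey = 0 ∧ ν eΩ = c}

end SE2

end Euclidean

/-! ### Constant two-forms on a vector space -/

section ConstForm

variable {V : Type*} [NormedAddCommGroup V] [NormedSpace ℝ V]

/-- A bilinear form on `V`, regarded as a bilinear form on each tangent space of `V`. -/
def constSection (b : V →L[ℝ] V →L[ℝ] ℝ) (x : V) :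
    TangentSpace 𝓘(ℝ, V) x →L[ℝ] TangentSpace 𝓘(ℝ, V) x →L[ℝ] ℝ := b

/-- An alternating bilinear form on a vector space, as a two-form with constant coefficients. -/
def constForm (b : V →L[ℝ] V →L[ℝ] ℝ) (hb : ∀ v, b v v = 0) : TwoForm 𝓘(ℝ, V) V where
  toFun := constSection b
  alternating _ v := hb v
  smooth := by
    intro x
    rw [Bundle.contMDiffAt_section]
    convert! contMDiffAt_const (c := b)
    ext v w
    rw [hom_trivializationAt_apply]
    simp only [ContinuousLinearMap.inCoordinates]
    simp
    rw [Bundle.Trivialization.linearMapAt_apply,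
      if_pos (by simp only [hom_trivializationAt_baseSet]; simp [chartAt_self_eq]),
      hom_trivializationAt_apply]
    simp [ContinuousLinearMap.inCoordinates]
    rfl

theorem constForm_isClosed (b : V →L[ℝ] V →L[ℝ] ℝ) (hb : ∀ v, b v v = 0) :
    (constForm b hb).IsClosed := by
  intro x X Y Z hX hY hZ
  have hX' : DifferentiableAt ℝ (show V → V from X) x :=
    (contMDiffAt_vectorSpace_iff_contDiffAt.1 hX).differentiableAt (by simp)
  have hY' : DifferentiableAt ℝ (show V → V from Y) x :=
    (contMDiffAt_vectorSpace_iff_contDiffAt.1 hY).differentiableAt (by simp)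
  have hZ' : DifferentiableAt ℝ (show V → V from Z) x :=
    (contMDiffAt_vectorSpace_iff_contDiffAt.1 hZ).differentiableAt (by simp)
  have key : ∀ (S T : V → V) (u : V), DifferentiableAt ℝ S x → DifferentiableAt ℝ T x →
      fderiv ℝ (fun y => b (S y) (T y)) x u
        = b (fderiv ℝ S x u) (T x) + b (S x) (fderiv ℝ T x u) := by
    intro S T u hS hT
    have := (b.hasFDerivAt.comp x hS.hasFDerivAt).clm_apply hT.hasFDerivAt
    have h2 := this.fderiv
    change fderiv ℝ (fun y => b (S y) (T y)) x = _ at h2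
    rw [h2]
    simp [add_comm]
  have hsymm : ∀ v w, b v w = - b w v := by
    intro v w
    have h := hb (v + w)
    simp only [map_add, add_apply, hb] at h
    linarith
  have dirEq : ∀ (f : V → ℝ) (u : V), dir (I := 𝓘(ℝ, V)) f x u = fderiv ℝ f x u := by
    intro f u
    simp only [dir, mfderiv_eq_fderiv]
    rfl
  have brEq : ∀ S T : V → V, VectorField.mlieBracket 𝓘(ℝ, V) (M := V) S T x
      = fderiv ℝ T x (S x) - fderiv ℝ S x (T x) := by
    intro S T
    have h1 := congrFun (VectorField.mlieBracketWithin_eq_lieBracketWithin (𝕜 := ℝ)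
      (V := S) (W := T) (s := univ)) x
    have h2 := congrFun (VectorField.lieBracketWithin_univ (𝕜 := ℝ) (V := S) (W := T)) x
    exact h1.trans h2
  have main : ∀ S T R : V → V, DifferentiableAt ℝ S x → DifferentiableAt ℝ T x →
      DifferentiableAt ℝ R x →
      fderiv ℝ (fun y => b (T y) (R y)) x (S x) - fderiv ℝ (fun y => b (S y) (R y)) x (T x)
      + fderiv ℝ (fun y => b (S y) (T y)) x (R x)
      - b (fderiv ℝ T x (S x) - fderiv ℝ S x (T x)) (R x)
      + b (fderiv ℝ R x (S x) - fderiv ℝ S x (R x)) (T x)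
      - b (fderiv ℝ R x (T x) - fderiv ℝ T x (R x)) (S x) = 0 := by
    intro S T R hS hT hR
    rw [key T R _ hT hR, key S R _ hS hR, key S T _ hS hT]
    simp only [map_sub, sub_apply]
    rw [hsymm (T x), hsymm (S x) (fderiv ℝ R x (T x)), hsymm (S x) (fderiv ℝ T x (R x))]
    ring
  have h := main X Y Z hX' hY' hZ'
  have e1 := brEq X Y
  have e2 := brEq X Z
  have e3 := brEq Y Z
  have d1 := dirEq (fun y => b (Y y) (Z y)) (X x)
  have d2 := dirEq (fun y => b (X y) (Z y)) (Y x)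
  have d3 := dirEq (fun y => b (X y) (Y y)) (Z x)
  refine Eq.trans ?_ h
  exact congrArg₂ (· - ·) (congrArg₂ (· + ·) (congrArg₂ (· - ·) (congrArg₂ (· + ·)
    (congrArg₂ (· - ·) d1 d2) d3) (congrArg (fun u => b u (Z x)) e1))
    (congrArg (fun u => b u (Y x)) e2)) (congrArg (fun u => b u (X x)) e3)

end ConstForm

/-! ### The symplectic form of `N` point vortices -/

section Vortices

variable {N : ℕ}

/-- The bilinear form `∑ᵢ Γᵢ (dxᵢ ∧ dyᵢ)(v, w)` on `ℝ^{2N} = ℂ^N`. -/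
def vortexBilin (Γ : Fin N → ℝ) : (Fin N → ℂ) →L[ℝ] (Fin N → ℂ) →L[ℝ] ℝ :=
  LinearMap.toContinuousLinearMap
    ((LinearMap.toContinuousLinearMap
      (𝕜 := ℝ) (E := Fin N → ℂ) (F' := ℝ)).toLinearMap ∘ₗ
    LinearMap.mk₂ ℝ (fun v w : Fin N → ℂ =>
      ∑ i, Γ i * ((v i).re * (w i).im - (w i).re * (v i).im))
      (fun v v' w => by
        rw [← Finset.sum_add_distrib]
        exact Finset.sum_congr rfl fun i _ => by simp; ring)
      (fun c v w => by
        rw [smul_eq_mul, Finset.mul_sum]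
        exact Finset.sum_congr rfl fun i _ => by simp; ring)
      (fun v w w' => by
        rw [← Finset.sum_add_distrib]
        exact Finset.sum_congr rfl fun i _ => by simp; ring)
      (fun c v w => by
        rw [smul_eq_mul, Finset.mul_sum]
        exact Finset.sum_congr rfl fun i _ => by simp; ring))

theorem vortexBilin_apply (Γ : Fin N → ℝ) (v w : Fin N → ℂ) :
    vortexBilin Γ v w = ∑ i, Γ i * ((v i).re * (w i).im - (w i).re * (v i).im) := rfl

theorem vortexBilin_self (Γ : Fin N → ℝ) (v : Fin N → ℂ) : vortexBilin Γ v v = 0 := by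
  rw [vortexBilin_apply]
  exact Finset.sum_eq_zero fun i _ => by ring

theorem vortexBilin_nondegenerate {Γ : Fin N → ℝ} (hΓ : ∀ i, Γ i ≠ 0) (v : Fin N → ℂ)
    (h : ∀ w, vortexBilin Γ v w = 0) : v = 0 := by
  funext i
  have h1 := h (Pi.single i Complex.I)
  have h2 := h (Pi.single i 1)
  rw [vortexBilin_apply, Finset.sum_eq_single i (by intro j _ hj; simp [hj]) (by simp)] at h1 h2
  simp [hΓ i] at h1 h2
  exact Complex.ext h1 h2

/-- The symplectic form `∑ᵢ Γᵢ dxᵢ ∧ dyᵢ` of `N` point vortices of nonzero strengths `Γᵢ`. -/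
def vortexForm (Γ : Fin N → ℝ) (hΓ : ∀ i, Γ i ≠ 0) :
    SymplecticForm 𝓘(ℝ, Fin N → ℂ) (Fin N → ℂ) where
  toTwoForm := constForm (vortexBilin Γ) (vortexBilin_self Γ)
  closed := constForm_isClosed _ _
  nondegenerate _ v h := vortexBilin_nondegenerate hΓ v h

end Vortices

end SymplecticLeaves

end

/-!
If the cocycle vanishes, the Hamiltonian vector field of `f` at `(μ, x)` has the `𝔥*`-component
`μ ∘ ad (δf/δμ)`, whatever `f` does on `P`. A curve in `𝔥*` whose velocity at each time `t` is
`μ t ∘ ad (ξ t)` stays in a coadjoint orbit: if `g` solves `g' = g (ξ t)` on the group, then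
`μ t ∘ Ad (g t)⁻¹` is constant. Solutions that exist for a time independent of the starting point
suffice, since membership in an orbit can be passed on from one time step to the next.

Conversely, the Hamiltonian `(ν, y) ↦ ν ξ` moves `μ` along `μ ∘ Ad (exp (t ξ))`. The `g` for which
every `μ ∘ Ad g` can be reached from `μ` by such curves form a submonoid of `H`; by the inverse
function theorem it is a neighbourhood of `1`, so it is all of `H`, which is connected. On `P`,
every short line in a chart is a trajectory, as some Hamiltonian has the required differential
along it; so all of `P` is reached, as `P` is connected.

For `SE(2)`, writing `m = Π_x + i Π_y`, the orbit of `(m, c)` consists of the points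
`(z m, c + Im (w * conj m))` with `|z| = 1` and `w ∈ ℂ`: a cylinder if `m ≠ 0`, a point otherwise.
-/

noncomputable section

namespace SymplecticLeaves

open Filter Topology

section Chart

variable {E : Type*} [NormedAddCommGroup E] [NormedSpace ℝ E]
  {A : Type*} [TopologicalSpace A] {I : ModelWithCorners ℝ E A} [I.Boundaryless]
  {M : Type*} [TopologicalSpace M] [ChartedSpace A M]
  {G : Type*} [NormedAddCommGroup G] [NormedSpace ℝ G]

theorem hasFDerivAt_comp_extChartAt_symm {f : M → G} {x : M} {f' : E →L[ℝ] G}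
    (hf : HasMFDerivAt I 𝓘(ℝ, G) f x f') :
    HasFDerivAt (fun v => f ((extChartAt I x).symm v)) f' (extChartAt I x x) := by
  have h := hf.2
  rw [ModelWithCorners.Boundaryless.range_eq_univ] at h
  exact (hasFDerivWithinAt_univ (E := E) (F := G)).1 h

theorem contMDiffAt_extChartAt_symm [IsManifold I ∞ M] {x : M} {u : E}
    (hu : u ∈ (extChartAt I x).target) :
    ContMDiffAt 𝓘(ℝ, E) I ∞ (extChartAt I x).symm u :=
  (contMDiffOn_extChartAt_symm x).contMDiffAt ((isOpen_extChartAt_target x).mem_nhds hu)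

theorem mfderiv_extChartAt_symm_comp_mfderiv_extChartAt [IsManifold I ∞ M] {x : M} {u : E}
    (hu : u ∈ (extChartAt I x).target) :
    (mfderiv 𝓘(ℝ, E) I (extChartAt I x).symm u : E →L[ℝ] E) ∘L
        (mfderiv I 𝓘(ℝ, E) (extChartAt I x) ((extChartAt I x).symm u) : E →L[ℝ] E)
      = ContinuousLinearMap.id ℝ E := by
  have h := mfderivWithin_extChartAt_symm_comp_mfderiv_extChartAt hu
  rwa [ModelWithCorners.Boundaryless.range_eq_univ, mfderivWithin_univ] at h

end Chart

section Velocity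

variable {E : Type*} [NormedAddCommGroup E] [NormedSpace ℝ E]
  {A : Type*} [TopologicalSpace A] (I : ModelWithCorners ℝ E A)
  {M : Type*} [TopologicalSpace M] [ChartedSpace A M]
  {F : Type*} [NormedAddCommGroup F] [NormedSpace ℝ F]
  {C : Type*} [TopologicalSpace C] (J : ModelWithCorners ℝ F C)
  {N : Type*} [TopologicalSpace N] [ChartedSpace C N]

/-- The curve `γ` in a manifold has the velocity `v` at `t` within `s`. Tangent spaces are modelled
on `E`, and `v` is taken there, so that velocities at different points can be compared. -/
def HasVelocityWithinAt (γ : ℝ → M) (v : E) (s : Set ℝ) (t : ℝ) : Prop :=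
  HasMFDerivWithinAt 𝓘(ℝ, ℝ) I γ s t ((1 : ℝ →L[ℝ] ℝ).smulRight v : ℝ →L[ℝ] E)

variable {I J} {γ : ℝ → M} {v : E} {s : Set ℝ} {t : ℝ}

theorem hasVelocityWithinAt_iff_hasDerivWithinAt {c : ℝ → E} :
    HasVelocityWithinAt 𝓘(ℝ, E) c v s t ↔ HasDerivWithinAt c v s t := by
  rw [hasDerivWithinAt_iff_hasFDerivWithinAt]
  exact hasMFDerivWithinAt_iff_hasFDerivWithinAt

theorem hasVelocityWithinAt_const (x : M) : HasVelocityWithinAt I (fun _ => x) 0 s t := by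
  rw [HasVelocityWithinAt, ContinuousLinearMap.smulRight_zero]
  exact hasMFDerivWithinAt_const x s t

theorem hasVelocityWithinAt_mfderiv (h : MDifferentiableAt 𝓘(ℝ, ℝ) I γ t) :
    HasVelocityWithinAt I γ (mfderiv 𝓘(ℝ, ℝ) I γ t (1 : ℝ)) univ t := by
  let T : ℝ →L[ℝ] E := mfderiv 𝓘(ℝ, ℝ) I γ t
  have hT : T = (1 : ℝ →L[ℝ] ℝ).smulRight (T 1) :=
    ContinuousLinearMap.ext_ring (one_smul ℝ (T 1)).symm
  have hγ : HasMFDerivWithinAt 𝓘(ℝ, ℝ) I γ univ t T := h.hasMFDerivAt.hasMFDerivWithinAt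
  rwa [hT] at hγ

theorem HasVelocityWithinAt.comp_hasMFDerivAt {f : M → N} {f' : E →L[ℝ] F}
    (h : HasVelocityWithinAt I γ v s t) (hf : HasMFDerivAt I J f (γ t) f') :
    HasVelocityWithinAt J (f ∘ γ) (f' v) s t := by
  have hcomp : f' ∘L (1 : ℝ →L[ℝ] ℝ).smulRight v = (1 : ℝ →L[ℝ] ℝ).smulRight (f' v) := by
    ext; simp
  rw [HasVelocityWithinAt, ← hcomp]
  exact hf.comp_hasMFDerivWithinAt t h

theorem HasVelocityWithinAt.prodMk {c : ℝ → N} {w : F} (h : HasVelocityWithinAt I γ v s t)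
    (hc : HasVelocityWithinAt J c w s t) :
    HasVelocityWithinAt (I.prod J) (fun τ => (γ τ, c τ)) ((v, w) : E × F) s t := by
  have hprod : ((1 : ℝ →L[ℝ] ℝ).smulRight v).prod ((1 : ℝ →L[ℝ] ℝ).smulRight w)
      = (1 : ℝ →L[ℝ] ℝ).smulRight ((v, w) : E × F) := by
    ext <;> simp
  rw [HasVelocityWithinAt, ← hprod]
  exact HasMFDerivWithinAt.prodMk h hc

theorem HasVelocityWithinAt.fst {γ : ℝ → M × N} {v : E × F}
    (h : HasVelocityWithinAt (I.prod J) γ v s t) :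
    HasVelocityWithinAt I (fun τ => (γ τ).1) v.1 s t :=
  h.comp_hasMFDerivAt (hasMFDerivAt_fst (I := I) (I' := J) (γ t))

theorem HasVelocityWithinAt.mfderiv_eq {γ : ℝ → M} {v : E} {t : ℝ}
    (h : HasVelocityWithinAt I γ v univ t) : (mfderiv 𝓘(ℝ, ℝ) I γ t (1 : ℝ) : E) = v := by
  have h' : HasMFDerivAt 𝓘(ℝ, ℝ) I γ t ((1 : ℝ →L[ℝ] ℝ).smulRight v : ℝ →L[ℝ] E) :=
    hasMFDerivWithinAt_univ.1 h
  rw [h'.mfderiv]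
  exact one_smul ℝ v

theorem isMIntegralCurveOn_iff_forall_hasVelocityWithinAt {X : ∀ x : M, TangentSpace I x} :
    IsMIntegralCurveOn γ X s ↔ ∀ t ∈ s, HasVelocityWithinAt I γ (X (γ t)) s t :=
  Iff.rfl

end Velocity

section SecondDerivative

variable {E : Type*} [NormedAddCommGroup E] [NormedSpace ℝ E]

theorem fderiv_intertwiner {m : E × E → E} {e : E} {a : E → E →L[ℝ] E} {a' : E →L[ℝ] E →L[ℝ] E}
    (hm : ContDiffAt ℝ 2 m (e, e)) (h1 : ∀ η, fderiv ℝ m (e, e) (η, 0) = η)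
    (ha : HasFDerivAt a a' e) (hae : a e = ContinuousLinearMap.id ℝ E)
    (h : ∀ᶠ u in 𝓝 e, ∀ η, fderiv ℝ m (e, u) (a u η, 0) = fderiv ℝ m (u, e) (0, η)) (ξ η : E) :
    a' ξ η = fderiv ℝ (fun u => fderiv ℝ m (u, e) (0, η)) e ξ
      - fderiv ℝ (fun u => fderiv ℝ m (u, e) (0, ξ)) e η := by
  set D := fderiv ℝ (fderiv ℝ m) (e, e)
  have hD : HasFDerivAt (fderiv ℝ m) D (e, e) :=
    ((hm.fderiv_right (m := 1) (by norm_num)).differentiableAt one_ne_zero).hasFDerivAt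
  have hsymm : D (η, 0) (0, ξ) = D (0, ξ) (η, 0) := hm.isSymmSndFDerivAt (by simp) _ _
  have hsnd (ζ : E) : HasFDerivAt (fun u => fderiv ℝ m (u, e) (0, ζ))
      ((D ∘L ContinuousLinearMap.inl ℝ E E).flip (0, ζ)) e := by
    simpa using (hD.comp (f := fun u => (u, e)) e (hasFDerivAt_prodMk_left e e)).clm_apply
      (hasFDerivAt_const ((0, ζ) : E × E) e)
  have hfst : HasFDerivAt (fun u => fderiv ℝ m (e, u) (a u η, 0))
      (fderiv ℝ m (e, e) ∘L ContinuousLinearMap.inl ℝ E E ∘L a'.flip η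
        + (D ∘L ContinuousLinearMap.inr ℝ E E).flip (a e η, 0)) e :=
    (hD.comp (f := fun u => (e, u)) e (hasFDerivAt_prodMk_right e e)).clm_apply
      ((ContinuousLinearMap.inl ℝ E E).hasFDerivAt.comp e
        (((ContinuousLinearMap.apply ℝ E η).hasFDerivAt).comp e ha))
  have hsum : a' ξ η + D (0, ξ) (η, 0) = D (ξ, 0) (0, η) := by
    have hunique := (hfst.congr_of_eventuallyEq (h.mono fun u hu => (hu η).symm)).unique (hsnd η)
    simpa [hae, h1] using DFunLike.congr_fun hunique ξ
  rw [(hsnd η).fderiv, (hsnd ξ).fderiv]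
  exact eq_sub_of_add_eq (hsum.symm ▸ congrArg (a' ξ η + ·) hsymm)

end SecondDerivative

section Adjoint

variable {E : Type*} [NormedAddCommGroup E] [NormedSpace ℝ E]
  {A : Type*} [TopologicalSpace A] (I : ModelWithCorners ℝ E A)
  {H : Type*} [TopologicalSpace H] [ChartedSpace A H] [Group H]

theorem Ad_one : Ad I (1 : H) = ContinuousLinearMap.id ℝ E := by
  have hconj : (fun h : H => 1 * h * 1⁻¹) = id := by ext; simp
  rw [Ad, hconj]
  exact mfderiv_id

variable [LieGroup I ∞ H]

theorem mdifferentiable_conj (g : H) : MDifferentiable I I (fun h : H => g * h * g⁻¹) :=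
  ((contMDiff_mul_right (I := I) (n := ∞) (a := g⁻¹)).comp
    (contMDiff_mul_left (I := I) (n := ∞) (a := g))).mdifferentiable (by simp)

theorem hasMFDerivAt_mul_left (g h : H) :
    HasMFDerivAt I I (g * ·) h (mfderiv I I (g * ·) h) :=
  ((contMDiff_mul_left (I := I) (n := ∞)).mdifferentiable (by simp) _).hasMFDerivAt

theorem hasMFDerivAt_mul_right (g h : H) :
    HasMFDerivAt I I (· * g) h (mfderiv I I (· * g) h) :=
  ((contMDiff_mul_right (I := I) (n := ∞)).mdifferentiable (by simp) _).hasMFDerivAt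

theorem hasMFDerivAt_conj_one (g : H) :
    HasMFDerivAt I I (fun h : H => g * h * g⁻¹) 1 (Ad I g : E →L[ℝ] E) :=
  (mdifferentiable_conj I g 1).hasMFDerivAt

theorem Ad_apply_eq_of_hasVelocityWithinAt {g : H} {γ : ℝ → H} {ξ η : E} {t : ℝ} (h1 : γ t = 1)
    (hγ : HasVelocityWithinAt I γ ξ univ t)
    (hconj : HasVelocityWithinAt I (fun τ => g * γ τ * g⁻¹) η univ t) :
    (Ad I g : E →L[ℝ] E) ξ = η := by
  have hAd : HasMFDerivAt I I (fun h : H => g * h * g⁻¹) (γ t) (Ad I g : E →L[ℝ] E) := by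
    rw [h1]
    exact hasMFDerivAt_conj_one I g
  exact (hγ.comp_hasMFDerivAt hAd).mfderiv_eq.symm.trans hconj.mfderiv_eq

theorem Ad_mul (g h : H) : Ad I (g * h) = (Ad I g).comp (Ad I h) := by
  have hg : HasMFDerivAt I I (fun k : H => g * k * g⁻¹) (h * 1 * h⁻¹) (Ad I g : E →L[ℝ] E) := by
    rw [mul_one, mul_inv_cancel]
    exact hasMFDerivAt_conj_one I g
  have hconj : (fun k : H => g * h * k * (g * h)⁻¹)
      = (fun k : H => g * k * g⁻¹) ∘ (fun k : H => h * k * h⁻¹) := by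
    ext k; simp [mul_assoc]
  rw [Ad, hconj]
  exact (hg.comp 1 (hasMFDerivAt_conj_one I h)).mfderiv

theorem mfderiv_mul_left_one_eq_comp_Ad (g : H) :
    (mfderiv I I (g * ·) (1 : H) : E →L[ℝ] E)
      = (mfderiv I I (· * g) (1 : H) : E →L[ℝ] E) ∘L (Ad I g : E →L[ℝ] E) := by
  have hright : HasMFDerivAt I I (· * g) (g * 1 * g⁻¹)
      (mfderiv I I (· * g) (1 : H) : E →L[ℝ] E) := by
    rw [mul_one, mul_inv_cancel]
    exact hasMFDerivAt_mul_right I g 1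
  have hmul : (g * · : H → H) = (· * g) ∘ (fun h => g * h * g⁻¹) := by
    ext h; simp
  rw [hmul]
  exact (hright.comp 1 (hasMFDerivAt_conj_one I g)).mfderiv

theorem inTangentCoordinates_conj_one (g : H) :
    inTangentCoordinates I I (fun _ : H => (1 : H)) (fun g => g * 1 * g⁻¹)
      (fun g => (mfderiv I I (fun h : H => g * h * g⁻¹) 1 : E →L[ℝ] E)) 1 g = Ad I g := by
  have hchart {x y : H} (hxy : x = y) :
      (mfderiv I 𝓘(ℝ, E) (extChartAt I x) y : E →L[ℝ] E) = ContinuousLinearMap.id ℝ E := by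
    rw [hxy]; exact mfderiv_extChartAt_self
  have hsymm : (mfderivWithin 𝓘(ℝ, E) I (extChartAt I (1 : H)).symm (range I)
      (extChartAt I (1 : H) 1) : E →L[ℝ] E) = ContinuousLinearMap.id ℝ E :=
    mfderivWithin_range_extChartAt_symm
  have hcoord := inTangentCoordinates_eq_mfderiv_comp (I := I) (I' := I)
    (f := fun _ : H => (1 : H)) (g := fun g : H => g * 1 * g⁻¹)
    (ϕ := fun g => mfderiv I I (fun h : H => g * h * g⁻¹) 1) (x₀ := 1) (x := g)
    (mem_chart_source A (1 : H)) (by simp)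
  refine hcoord.trans ?_
  exact (congrArg₂ (fun S T : E →L[ℝ] E => S ∘L Ad I g ∘L T) (hchart (by simp)) hsymm).trans
    (by simp)

theorem contMDiffAt_Ad_one : ContMDiffAt I 𝓘(ℝ, E →L[ℝ] E) ∞ (Ad I : H → E →L[ℝ] E) 1 := by
  have hconj : ContMDiffAt (I.prod I) I ∞
      (Function.uncurry fun g h : H => g * h * g⁻¹) (1, 1) :=
    ((contMDiff_fst.mul contMDiff_snd).mul contMDiff_fst.inv).contMDiffAt
  exact (ContMDiffAt.mfderiv (m := ∞) (fun g h : H => g * h * g⁻¹) (fun _ => 1) hconj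
    contMDiffAt_const (by simp)).congr_of_eventuallyEq
      (.of_eq (funext fun g => (inTangentCoordinates_conj_one I g).symm))

theorem contMDiff_Ad : ContMDiff I 𝓘(ℝ, E →L[ℝ] E) ∞ (Ad I : H → E →L[ℝ] E) := by
  intro g
  have htranslate : (Ad I : H → E →L[ℝ] E)
      = fun h => ContinuousLinearMap.compL ℝ E E E (Ad I g) (Ad I (g⁻¹ * h)) := by
    ext h : 1
    rw [ContinuousLinearMap.compL_apply, ← Ad_mul, mul_inv_cancel_left]
  rw [htranslate]
  have hone := contMDiffAt_Ad_one I (H := H)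
  rw [← inv_mul_cancel g] at hone
  exact (ContinuousLinearMap.contMDiff _).contMDiffAt.comp g
    (hone.comp g (contMDiff_mul_left (I := I) (n := ∞)).contMDiffAt)

variable (H) in
/-- The adjoint representation `ad` of the Lie algebra, as the derivative of `Ad` at the identity.
It is shown in `lieBr_eq_ad` that `ad ξ η = [ξ, η]`. -/
def ad : E →L[ℝ] E →L[ℝ] E := mfderiv I 𝓘(ℝ, E →L[ℝ] E) (Ad I : H → E →L[ℝ] E) 1

theorem hasMFDerivAt_Ad_one :
    HasMFDerivAt I 𝓘(ℝ, E →L[ℝ] E) (Ad I : H → E →L[ℝ] E) 1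
      (ad I H : E →L[ℝ] E →L[ℝ] E) :=
  ((contMDiff_Ad I).mdifferentiable (by simp) 1).hasMFDerivAt

theorem mfderiv_Ad_mulInvariantVectorField (g : H) (ξ : E) :
    (mfderiv I 𝓘(ℝ, E →L[ℝ] E) (Ad I : H → E →L[ℝ] E) g
      (mulInvariantVectorField (I := I) (G := H) ξ g) : E →L[ℝ] E)
      = (Ad I g).comp (ad I H ξ) := by
  have hg : HasMFDerivAt I 𝓘(ℝ, E →L[ℝ] E) (Ad I : H → E →L[ℝ] E) (g * 1)
      (mfderiv I 𝓘(ℝ, E →L[ℝ] E) (Ad I : H → E →L[ℝ] E) g) := by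
    rw [mul_one]
    exact ((contMDiff_Ad I).mdifferentiable (by simp) g).hasMFDerivAt
  have hleft := hg.comp 1 (hasMFDerivAt_mul_left I g 1)
  have hright : HasMFDerivAt I 𝓘(ℝ, E →L[ℝ] E)
      (ContinuousLinearMap.compL ℝ E E E (Ad I g) ∘ Ad I) (1 : H)
      (ContinuousLinearMap.compL ℝ E E E (Ad I g) ∘L (ad I H : E →L[ℝ] E →L[ℝ] E)) :=
    (ContinuousLinearMap.hasMFDerivAt _).comp (1 : H) (hasMFDerivAt_Ad_one I)
  have hAd : (Ad I : H → E →L[ℝ] E) ∘ (g * ·)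
      = ContinuousLinearMap.compL ℝ E E E (Ad I g) ∘ Ad I := funext fun h => Ad_mul I g h
  rw [hAd] at hleft
  exact DFunLike.congr_fun (hasMFDerivAt_unique hleft hright) ξ

theorem HasVelocityWithinAt.Ad {γ : ℝ → H} {ξ : E} {s : Set ℝ} {t : ℝ}
    (h : HasVelocityWithinAt I γ (mulInvariantVectorField (I := I) (G := H) ξ (γ t) : E) s t) :
    HasDerivWithinAt (fun τ => Ad I (γ τ)) ((Ad I (γ t)).comp (ad I H ξ)) s t := by
  have hAd := h.comp_hasMFDerivAt ((contMDiff_Ad I).mdifferentiable (by simp) _).hasMFDerivAt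
  exact mfderiv_Ad_mulInvariantVectorField I (γ t) ξ ▸
    hasVelocityWithinAt_iff_hasDerivWithinAt.1 hAd

end Adjoint

section GroupChart

variable {E : Type*} [NormedAddCommGroup E] [NormedSpace ℝ E]
  {A : Type*} [TopologicalSpace A] (I : ModelWithCorners ℝ E A)
  (H : Type*) [TopologicalSpace H] [ChartedSpace A H] [Group H]

/-- The coordinates of the identity of `H` in the preferred chart at the identity. -/
def chartOne : E := extChartAt I (1 : H) 1

/-- The element of `H` with given coordinates in the preferred chart at the identity, with junk
values off the target of the chart. -/
def ofChart (u : E) : H := (extChartAt I (1 : H)).symm u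

/-- The multiplication of `H` in the preferred chart at the identity. -/
def chartMul (p : E × E) : E := extChartAt I (1 : H) (ofChart I H p.1 * ofChart I H p.2)

/-- The left-invariant vector fields in the preferred chart at the identity: `chartLeft I H u ξ` is
the value at the point with coordinates `u` of the one generated by `ξ`. -/
def chartLeft (u : E) : E →L[ℝ] E :=
  (mfderiv I 𝓘(ℝ, E) (extChartAt I (1 : H)) (ofChart I H u) : E →L[ℝ] E) ∘L
    (mfderiv I I (ofChart I H u * ·) (1 : H) : E →L[ℝ] E)

@[simp]
theorem ofChart_chartOne : ofChart I H (chartOne I H) = 1 := extChartAt_to_inv _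

theorem mpullbackWithin_mulInvariantVectorField [IsManifold I 1 H] {u : E}
    (hu : u ∈ (extChartAt I (1 : H)).target) (ξ : E) :
    (VectorField.mpullbackWithin 𝓘(ℝ, E) I (extChartAt I (1 : H)).symm
      (mulInvariantVectorField (I := I) (G := H) ξ) (range I) u : E) = chartLeft I H u ξ := by
  rw [VectorField.mpullbackWithin_apply, ContinuousLinearMap.inverse_eq
    (mfderivWithin_extChartAt_symm_comp_mfderiv_extChartAt hu)
    (mfderiv_extChartAt_comp_mfderivWithin_extChartAt_symm hu)]
  rfl

variable [I.Boundaryless]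

theorem target_mem_nhds_chartOne : (extChartAt I (1 : H)).target ∈ 𝓝 (chartOne I H) :=
  extChartAt_target_mem_nhds (1 : H)

theorem eventually_chartMul_chartOne_right :
    ∀ᶠ u in 𝓝 (chartOne I H), chartMul I H (u, chartOne I H) = u := by
  filter_upwards [target_mem_nhds_chartOne I H] with u hu
  simp only [chartMul, ofChart_chartOne, mul_one]
  exact (extChartAt I (1 : H)).right_inv hu

theorem eventually_chartMul_chartOne_left :
    ∀ᶠ u in 𝓝 (chartOne I H), chartMul I H (chartOne I H, u) = u := by
  filter_upwards [target_mem_nhds_chartOne I H] with u hu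
  simp only [chartMul, ofChart_chartOne, one_mul]
  exact (extChartAt I (1 : H)).right_inv hu

variable [LieGroup I ∞ H]

theorem contMDiffAt_ofChart : ContMDiffAt 𝓘(ℝ, E) I ∞ (ofChart I H) (chartOne I H) :=
  contMDiffAt_extChartAt_symm (mem_extChartAt_target (1 : H))

theorem contMDiffAt_ofChart_mul_ofChart :
    ContMDiffAt 𝓘(ℝ, E × E) I ∞ (fun p : E × E => ofChart I H p.1 * ofChart I H p.2)
      (chartOne I H, chartOne I H) := by
  have hfst : ContMDiffAt 𝓘(ℝ, E × E) I ∞ (fun p : E × E => ofChart I H p.1)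
      (chartOne I H, chartOne I H) :=
    ContMDiffAt.comp (f := Prod.fst) _ (contMDiffAt_ofChart I H) contDiffAt_fst.contMDiffAt
  have hsnd : ContMDiffAt 𝓘(ℝ, E × E) I ∞ (fun p : E × E => ofChart I H p.2)
      (chartOne I H, chartOne I H) :=
    ContMDiffAt.comp (f := Prod.snd) _ (contMDiffAt_ofChart I H) contDiffAt_snd.contMDiffAt
  exact hfst.mul hsnd

theorem contDiffAt_chartMul :
    ContDiffAt ℝ ∞ (chartMul I H) (chartOne I H, chartOne I H) := by
  have hchart : ContMDiffAt I 𝓘(ℝ, E) ∞ (extChartAt I (1 : H))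
      (ofChart I H (chartOne I H) * ofChart I H (chartOne I H)) := by
    rw [ofChart_chartOne, mul_one]
    exact contMDiffAt_extChartAt
  exact (hchart.comp (chartOne I H, chartOne I H) (contMDiffAt_ofChart_mul_ofChart I H)).contDiffAt

theorem eventually_ofChart_chartMul :
    ∀ᶠ p in 𝓝 (chartOne I H, chartOne I H),
      ofChart I H (chartMul I H p) = ofChart I H p.1 * ofChart I H p.2 := by
  have hsource : (extChartAt I (1 : H)).source
      ∈ 𝓝 (ofChart I H (chartOne I H) * ofChart I H (chartOne I H)) := by
    rw [ofChart_chartOne, mul_one]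
    exact extChartAt_source_mem_nhds 1
  exact ((contMDiffAt_ofChart_mul_ofChart I H).continuousAt.eventually_mem hsource).mono
    fun p hp => (extChartAt I (1 : H)).left_inv hp

theorem fderiv_chartMul_chartOne (η ζ : E) :
    fderiv ℝ (chartMul I H) (chartOne I H, chartOne I H) (η, ζ) = η + ζ := by
  have hmul := ((contDiffAt_chartMul I H).differentiableAt (by simp)).hasFDerivAt
  have hη := (hmul.comp (f := fun u => (u, chartOne I H)) _ (hasFDerivAt_prodMk_left _ _)).unique
    ((hasFDerivAt_id _).congr_of_eventuallyEq (eventually_chartMul_chartOne_right I H))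
  have hζ := (hmul.comp (f := fun u => (chartOne I H, u)) _ (hasFDerivAt_prodMk_right _ _)).unique
    ((hasFDerivAt_id _).congr_of_eventuallyEq (eventually_chartMul_chartOne_left I H))
  calc fderiv ℝ (chartMul I H) (chartOne I H, chartOne I H) (η, ζ)
      = fderiv ℝ (chartMul I H) (chartOne I H, chartOne I H) (η, 0)
        + fderiv ℝ (chartMul I H) (chartOne I H, chartOne I H) (0, ζ) := by
        rw [← map_add, Prod.mk_add_mk, add_zero, zero_add]
    _ = η + ζ := congrArg₂ (· + ·) (DFunLike.congr_fun hη η) (DFunLike.congr_fun hζ ζ)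

theorem hasFDerivAt_extChartAt_comp_ofChart {k : H → H} {k' : E →L[ℝ] E} {u : E}
    (hu : u ∈ (extChartAt I (1 : H)).target) (hk : HasMFDerivAt I I k 1 k')
    (hk1 : k 1 = ofChart I H u) :
    HasFDerivAt (fun v => extChartAt I (1 : H) (k (ofChart I H v)))
      ((mfderiv I 𝓘(ℝ, E) (extChartAt I (1 : H)) (ofChart I H u) : E →L[ℝ] E) ∘L k')
      (chartOne I H) := by
  have hsource : ofChart I H u ∈ (chartAt A (1 : H)).source := by
    rw [← extChartAt_source I]
    exact (extChartAt I (1 : H)).map_target hu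
  have hchart : HasMFDerivAt I 𝓘(ℝ, E) (extChartAt I (1 : H)) (k 1)
      (mfderiv I 𝓘(ℝ, E) (extChartAt I (1 : H)) (ofChart I H u) : E →L[ℝ] E) := by
    rw [hk1]
    exact (mdifferentiableAt_extChartAt hsource).hasMFDerivAt
  exact hasFDerivAt_comp_extChartAt_symm (hchart.comp 1 hk)

theorem eventually_fderiv_chartMul_inr : ∀ᶠ u in 𝓝 (chartOne I H), ∀ η,
    fderiv ℝ (chartMul I H) (u, chartOne I H) (0, η) = chartLeft I H u η := by
  have hdiff : ∀ᶠ u in 𝓝 (chartOne I H), ContDiffAt ℝ 1 (chartMul I H) (u, chartOne I H) :=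
    (Continuous.prodMk_left (chartOne I H)).continuousAt.eventually
      (((contDiffAt_chartMul I H).of_le (by simp)).eventually (by simp))
  filter_upwards [target_mem_nhds_chartOne I H, hdiff] with u hu hmul η
  have hpartial := (hmul.differentiableAt one_ne_zero).hasFDerivAt.comp (f := fun v => (u, v)) _
    (hasFDerivAt_prodMk_right u _)
  exact DFunLike.congr_fun (hpartial.unique (hasFDerivAt_extChartAt_comp_ofChart I H hu
    (hasMFDerivAt_mul_left I _ 1) (mul_one _))) η

theorem eventually_fderiv_chartMul_Ad : ∀ᶠ u in 𝓝 (chartOne I H), ∀ η,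
    fderiv ℝ (chartMul I H) (chartOne I H, u) (Ad I (ofChart I H u) η, 0)
      = fderiv ℝ (chartMul I H) (u, chartOne I H) (0, η) := by
  have hdiff : ∀ᶠ u in 𝓝 (chartOne I H), ContDiffAt ℝ 1 (chartMul I H) (chartOne I H, u) :=
    (Continuous.prodMk_right (chartOne I H)).continuousAt.eventually
      (((contDiffAt_chartMul I H).of_le (by simp)).eventually (by simp))
  filter_upwards [target_mem_nhds_chartOne I H, hdiff, eventually_fderiv_chartMul_inr I H]
    with u hu hmul hinr η
  have hpartial := (hmul.differentiableAt one_ne_zero).hasFDerivAt.comp (f := fun v => (v, u)) _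
    (hasFDerivAt_prodMk_left _ u)
  have hinl := hpartial.unique (hasFDerivAt_extChartAt_comp_ofChart I H hu
    (hasMFDerivAt_mul_right I _ 1) (one_mul _))
  rw [hinr, chartLeft, mfderiv_mul_left_one_eq_comp_Ad]
  exact DFunLike.congr_fun hinl (Ad I (ofChart I H u) η)

theorem contDiffAt_chartLeft : ContDiffAt ℝ ∞ (chartLeft I H) (chartOne I H) := by
  have hinr : ContDiffAt ℝ ∞ (fun u => fderiv ℝ (chartMul I H) (u, chartOne I H) ∘L
      ContinuousLinearMap.inr ℝ E E) (chartOne I H) :=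
    (((contDiffAt_chartMul I H).fderiv_right (m := ∞) (by simp)).comp
      (f := fun u => (u, chartOne I H)) _ (contDiffAt_id.prodMk contDiffAt_const)).clm_comp
      contDiffAt_const
  refine hinr.congr_of_eventuallyEq ((eventually_fderiv_chartMul_inr I H).mono fun u hu => ?_)
  ext η
  exact (hu η).symm

@[simp]
theorem chartLeft_chartOne : chartLeft I H (chartOne I H) = ContinuousLinearMap.id ℝ E := by
  ext η
  rw [← (eventually_fderiv_chartMul_inr I H).self_of_nhds, fderiv_chartMul_chartOne]
  simp

theorem mfderiv_ofChart_chartLeft {u : E} (hu : u ∈ (extChartAt I (1 : H)).target) (ξ : E) :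
    (mfderiv 𝓘(ℝ, E) I (ofChart I H) u : E →L[ℝ] E) (chartLeft I H u ξ)
      = mulInvariantVectorField (I := I) (G := H) ξ (ofChart I H u) :=
  DFunLike.congr_fun (mfderiv_extChartAt_symm_comp_mfderiv_extChartAt hu) _

theorem ad_eq_fderiv_chartLeft_sub (ξ η : E) :
    ad I H ξ η = fderiv ℝ (fun u => chartLeft I H u η) (chartOne I H) ξ
      - fderiv ℝ (fun u => chartLeft I H u ξ) (chartOne I H) η := by
  have hleft (ζ : E) : (fun u => fderiv ℝ (chartMul I H) (u, chartOne I H) (0, ζ))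
      =ᶠ[𝓝 (chartOne I H)] fun u => chartLeft I H u ζ :=
    (eventually_fderiv_chartMul_inr I H).mono fun u hu => hu ζ
  rw [← (hleft ξ).fderiv_eq, ← (hleft η).fderiv_eq]
  exact fderiv_intertwiner ((contDiffAt_chartMul I H).of_le (by norm_cast))
    (fun ζ => by rw [fderiv_chartMul_chartOne, add_zero])
    (hasFDerivAt_comp_extChartAt_symm (hasMFDerivAt_Ad_one I))
    ((congrArg (Ad I) (ofChart_chartOne I H)).trans (Ad_one I))
    (eventually_fderiv_chartMul_Ad I H) ξ η

theorem lieBr_eq_ad (ξ η : E) : lieBr I H ξ η = ad I H ξ η := by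
  let V (ζ : E) : E → E := VectorField.mpullbackWithin 𝓘(ℝ, E) I (extChartAt I (1 : H)).symm
    (mulInvariantVectorField (I := I) (G := H) ζ) (range I)
  let T : E →L[ℝ] E := mfderiv I 𝓘(ℝ, E) (extChartAt I (1 : H)) 1
  have hT : T = ContinuousLinearMap.id ℝ E := mfderiv_extChartAt_self
  have hbr : lieBr I H ξ η = T.inverse (VectorField.lieBracketWithin ℝ (V ξ) (V η)
      ((extChartAt I (1 : H)).symm ⁻¹' univ ∩ range I) (chartOne I H)) := rfl
  have hV (ζ : E) : V ζ =ᶠ[𝓝 (chartOne I H)] fun u => chartLeft I H u ζ :=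
    eventually_of_mem (target_mem_nhds_chartOne I H)
      fun u hu => mpullbackWithin_mulInvariantVectorField I H hu ζ
  rw [hbr, hT, preimage_univ, univ_inter, ModelWithCorners.Boundaryless.range_eq_univ,
    VectorField.lieBracketWithin_univ, ContinuousLinearMap.inverse_id,
    ContinuousLinearMap.id_apply, (hV ξ).lieBracket_vectorField_eq (hV η),
    ad_eq_fderiv_chartLeft_sub]
  simp [VectorField.lieBracket_eq]

theorem ad_swap (ξ η : E) : ad I H ξ η = -ad I H η ξ := by
  simp only [ad_eq_fderiv_chartLeft_sub I H, neg_sub]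

end GroupChart

section LinearODE

open Metric
open scoped NNReal

variable {E : Type*} [NormedAddCommGroup E] [NormedSpace ℝ E]

-- `IsPicardLindelof.exists_eq_forall_mem_Icc_hasDerivWithinAt` does not say that the solution
-- stays in the ball on which the vector field is controlled.
theorem exists_hasDerivWithinAt_mem_closedBall_of_isPicardLindelof [CompleteSpace E]
    {f : ℝ → E → E} {tmin tmax : ℝ} {t₀ : Icc tmin tmax} {x₀ : E} {a L K : ℝ≥0}
    (hf : IsPicardLindelof f t₀ x₀ a 0 L K) :
    ∃ α : ℝ → E, α t₀ = x₀ ∧ ∀ t ∈ Icc tmin tmax, α t ∈ closedBall x₀ a ∧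
      HasDerivWithinAt α (f t (α t)) (Icc tmin tmax) t := by
  obtain ⟨α, hα⟩ := ODE.FunSpace.exists_isFixedPt_next hf
    (show x₀ ∈ closedBall x₀ ((0 : ℝ≥0) : ℝ) from mem_closedBall_self le_rfl)
  have hmem (t : ℝ) : α.compProj t ∈ closedBall x₀ a := α.compProj_mem_closedBall hf.mul_max_le
  refine ⟨α.compProj, by rw [ODE.FunSpace.compProj_val, ← hα, ODE.FunSpace.next_apply₀],
    fun t ht => ⟨hmem t, ?_⟩⟩
  refine (ODE.hasDerivWithinAt_picard_Icc t₀.2 hf.continuousOn_uncurry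
    α.continuous_compProj.continuousOn (fun t _ => hmem t) x₀ ht).congr_of_mem (fun τ hτ => ?_) ht
  nth_rw 1 [← hα]
  rw [ODE.FunSpace.compProj_of_mem hτ, ODE.FunSpace.next_apply]

theorem isPicardLindelof_clm_apply {L : E → E →L[ℝ] E} {u₀ : E} {r C K B : ℝ≥0} {ξ : ℝ → E}
    {s t : ℝ} (hK : LipschitzOnWith K L (closedBall u₀ r)) (hC : ∀ u ∈ closedBall u₀ r, ‖L u‖ ≤ C)
    (hξ : ContinuousOn ξ (Icc s t)) (hB : ∀ τ ∈ Icc s t, ‖ξ τ‖ ≤ B) (hst : s ≤ t)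
    (hr : C * B * (t - s) ≤ r) :
    IsPicardLindelof (fun τ u => L u (ξ τ)) (tmin := s) (tmax := t) ⟨s, left_mem_Icc.2 hst⟩ u₀ r 0
      (C * B) (K * B) where
  lipschitzOnWith τ hτ := LipschitzOnWith.of_dist_le_mul fun u hu v hv => by
    calc dist (L u (ξ τ)) (L v (ξ τ)) ≤ dist (L u) (L v) * ‖ξ τ‖ := by
          rw [dist_eq_norm, dist_eq_norm, ← sub_apply]
          exact ContinuousLinearMap.le_opNorm _ _
      _ ≤ (K * dist u v) * B := by
          gcongr
          exacts [hK.dist_le_mul u hu v hv, hB τ hτ]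
      _ = (K * B : ℝ≥0) * dist u v := by push_cast; ring
  continuousOn u _ := (L u).continuous.comp_continuousOn hξ
  norm_le τ hτ u hu := (ContinuousLinearMap.le_opNorm _ _).trans <| by
    push_cast
    exact mul_le_mul (hC u hu) (hB τ hτ) (norm_nonneg _) C.2
  mul_max_le := by simpa [hst] using hr

theorem eqOn_of_hasDerivWithinAt_comp {G : Type*} [NormedAddCommGroup G] [NormedSpace ℝ G]
    {T : ℝ → E →L[ℝ] E} {μ ν : ℝ → E →L[ℝ] G} {s t : ℝ} {B : ℝ≥0}
    (hT : ∀ τ ∈ Icc s t, ‖T τ‖ ≤ B)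
    (hμ : ∀ τ ∈ Icc s t, HasDerivWithinAt μ ((μ τ).comp (T τ)) (Icc s t) τ)
    (hν : ∀ τ ∈ Icc s t, HasDerivWithinAt ν ((ν τ).comp (T τ)) (Icc s t) τ) (hs : μ s = ν s) :
    EqOn μ ν (Icc s t) := by
  have hlip (τ : ℝ) (hτ : τ ∈ Ico s t) :
      LipschitzOnWith B (fun ν : E →L[ℝ] G => ν.comp (T τ)) univ :=
    LipschitzOnWith.of_dist_le_mul fun ν _ κ _ => by
      rw [dist_eq_norm, dist_eq_norm, ← ContinuousLinearMap.sub_comp, mul_comm]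
      exact (ContinuousLinearMap.opNorm_comp_le _ _).trans
        (mul_le_mul_of_nonneg_left (hT τ (Ico_subset_Icc_self hτ)) (norm_nonneg _))
  have hright {κ : ℝ → E →L[ℝ] G}
      (hκ : ∀ τ ∈ Icc s t, HasDerivWithinAt κ ((κ τ).comp (T τ)) (Icc s t) τ) (τ : ℝ)
      (hτ : τ ∈ Ico s t) : HasDerivWithinAt κ ((κ τ).comp (T τ)) (Ici τ) τ :=
    (hκ τ (Ico_subset_Icc_self hτ)).mono_of_mem_nhdsWithin (Icc_mem_nhdsGE_of_mem hτ)
  exact ODE_solution_unique_of_mem_Icc_right (s := fun _ => univ) hlip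
    (fun τ hτ => (hμ τ hτ).continuousWithinAt) (hright hμ) (fun _ _ => mem_univ _)
    (fun τ hτ => (hν τ hτ).continuousWithinAt) (hright hν) (fun _ _ => mem_univ _) hs

end LinearODE

section CoadjointOrbit

open Metric
open scoped NNReal

variable {E : Type*} [NormedAddCommGroup E] [NormedSpace ℝ E]
  {A : Type*} [TopologicalSpace A] (I : ModelWithCorners ℝ E A)
  {H : Type*} [TopologicalSpace H] [ChartedSpace A H] [Group H]

theorem comp_Ad_mem_coadjointOrbit (μ : E →L[ℝ] ℝ) (g : H) :
    μ.comp (Ad I g) ∈ coadjointOrbit I H μ := ⟨g⁻¹, by rw [inv_inv]⟩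

variable (H) in
theorem mem_coadjointOrbit_self (μ : E →L[ℝ] ℝ) : μ ∈ coadjointOrbit I H μ := by
  simpa only [Ad_one, ContinuousLinearMap.comp_id] using comp_Ad_mem_coadjointOrbit I μ (1 : H)

variable {I} [LieGroup I ∞ H]

theorem mem_coadjointOrbit_trans {μ ν κ : E →L[ℝ] ℝ} (hν : ν ∈ coadjointOrbit I H μ)
    (hκ : κ ∈ coadjointOrbit I H ν) : κ ∈ coadjointOrbit I H μ := by
  obtain ⟨g, rfl⟩ := hν
  obtain ⟨k, rfl⟩ := hκ
  rw [ContinuousLinearMap.comp_assoc, ← Ad_mul]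
  exact comp_Ad_mem_coadjointOrbit I μ _

theorem mem_coadjointOrbit_symm {μ ν : E →L[ℝ] ℝ} (hν : ν ∈ coadjointOrbit I H μ) :
    μ ∈ coadjointOrbit I H ν := by
  obtain ⟨g, rfl⟩ := hν
  refine ⟨g⁻¹, ?_⟩
  rw [inv_inv, ContinuousLinearMap.comp_assoc, ← Ad_mul, inv_mul_cancel, Ad_one,
    ContinuousLinearMap.comp_id]

variable (I) in
theorem hasDerivWithinAt_comp_Ad {g : ℝ → H} {ξ : E} {s : Set ℝ} {t : ℝ} (μ : E →L[ℝ] ℝ)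
    (hg : HasVelocityWithinAt I g (mulInvariantVectorField (I := I) (G := H) ξ (g t) : E) s t) :
    HasDerivWithinAt (fun τ => μ.comp (Ad I (g τ))) ((μ.comp (Ad I (g t))).comp (ad I H ξ)) s t :=
  (ContinuousLinearMap.compL ℝ E E ℝ μ).hasFDerivAt.comp_hasDerivWithinAt t hg.Ad

variable (I H) [I.Boundaryless]

theorem exists_closedBall_chartLeft : ∃ r C K : ℝ≥0, 0 < r ∧
    closedBall (chartOne I H) r ⊆ (extChartAt I (1 : H)).target ∧
    LipschitzOnWith K (chartLeft I H) (closedBall (chartOne I H) r) ∧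
    ∀ u ∈ closedBall (chartOne I H) r, ‖chartLeft I H u‖ ≤ C := by
  have hsmooth := contDiffAt_chartLeft I H
  obtain ⟨K, s, hs, hK⟩ := (hsmooth.of_le (m := 1) (by simp)).exists_lipschitzOnWith
  have hC : ∀ᶠ u in 𝓝 (chartOne I H), ‖chartLeft I H u‖ < ‖chartLeft I H (chartOne I H)‖ + 1 :=
    hsmooth.continuousAt.norm.eventually_lt_const (lt_add_one _)
  obtain ⟨r, hr, hball⟩ := nhds_basis_closedBall.mem_iff.1
    (inter_mem (inter_mem (target_mem_nhds_chartOne I H) hs) hC)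
  exact ⟨⟨r, hr.le⟩, ‖chartLeft I H (chartOne I H)‖₊ + 1, K, hr, fun u hu => (hball hu).1.1,
    hK.mono fun u hu => (hball hu).1.2, fun u hu => (hball hu).2.le⟩

theorem hasVelocityWithinAt_ofChart_comp {u : ℝ → E} {ξ : E} {s : Set ℝ} {t : ℝ}
    (hut : u t ∈ (extChartAt I (1 : H)).target)
    (hu : HasDerivWithinAt u (chartLeft I H (u t) ξ) s t) :
    HasVelocityWithinAt I (ofChart I H ∘ u)
      (mulInvariantVectorField (I := I) (G := H) ξ (ofChart I H (u t)) : E) s t := by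
  have hchart : HasMFDerivAt 𝓘(ℝ, E) I (ofChart I H) (u t)
      (mfderiv 𝓘(ℝ, E) I (ofChart I H) (u t) : E →L[ℝ] E) :=
    ((contMDiffAt_extChartAt_symm hut).mdifferentiableAt (by simp)).hasMFDerivAt
  have hγ := (hasVelocityWithinAt_iff_hasDerivWithinAt.2 hu).comp_hasMFDerivAt hchart
  exact mfderiv_ofChart_chartLeft I H hut ξ ▸ hγ

theorem exists_hasVelocityWithinAt_mulInvariantVectorField [CompleteSpace E] (B : ℝ≥0) :
    ∃ ε > 0, ∀ (ξ : ℝ → E) (s t : ℝ), s ≤ t → t - s ≤ ε → ContinuousOn ξ (Icc s t) →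
      (∀ τ ∈ Icc s t, ‖ξ τ‖ ≤ B) →
      ∃ g : ℝ → H, g s = 1 ∧ ∀ τ ∈ Icc s t, HasVelocityWithinAt I g
        (mulInvariantVectorField (I := I) (G := H) (ξ τ) (g τ) : E) (Icc s t) τ := by
  obtain ⟨r, C, K, hr, htarget, hK, hC⟩ := exists_closedBall_chartLeft I H
  refine ⟨r / (C * B + 1), div_pos (NNReal.coe_pos.2 hr) (by positivity),
    fun ξ s t hst hts hξ hB => ?_⟩
  have hshort : C * B * (t - s) ≤ r :=
    calc C * B * (t - s) ≤ (C * B + 1) * (r / (C * B + 1)) := by gcongr; linarith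
      _ = r := mul_div_cancel₀ _ (by positivity)
  obtain ⟨u, hu0, hu⟩ := exists_hasDerivWithinAt_mem_closedBall_of_isPicardLindelof
    (isPicardLindelof_clm_apply hK hC hξ hB hst hshort)
  exact ⟨ofChart I H ∘ u, (congrArg (ofChart I H) hu0).trans (ofChart_chartOne I H), fun τ hτ =>
    hasVelocityWithinAt_ofChart_comp I H (htarget (hu τ hτ).1) (hu τ hτ).2⟩

theorem mem_coadjointOrbit_of_hasDerivWithinAt [CompleteSpace E] {μ : ℝ → E →L[ℝ] ℝ} {ξ : ℝ → E}
    {a b : ℝ} (hab : a ≤ b) (hξ : ContinuousOn ξ (Icc a b))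
    (hμ : ∀ t ∈ Icc a b, HasDerivWithinAt μ ((μ t).comp (ad I H (ξ t))) (Icc a b) t) :
    μ b ∈ coadjointOrbit I H (μ a) := by
  obtain ⟨B₀, hB₀⟩ := isCompact_Icc.exists_bound_of_continuousOn hξ
  have hB (t : ℝ) (ht : t ∈ Icc a b) : ‖ξ t‖ ≤ B₀.toNNReal :=
    (hB₀ t ht).trans (Real.le_coe_toNNReal _)
  obtain ⟨ε, hε, hdevelop⟩ := exists_hasVelocityWithinAt_mulInvariantVectorField I H B₀.toNNReal
  have hshort (s : ℝ) (hs : s ∈ Icc a b) (t : ℝ) (ht : t ∈ Icc a b) (hst : s ≤ t)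
      (hts : t - s ≤ ε) : μ t ∈ coadjointOrbit I H (μ s) := by
    have hsub : Icc s t ⊆ Icc a b := Icc_subset_Icc hs.1 ht.2
    obtain ⟨g, hgs, hg⟩ :=
      hdevelop ξ s t hst hts (hξ.mono hsub) fun τ hτ => hB τ (hsub hτ)
    have had (τ : ℝ) (hτ : τ ∈ Icc s t) : ‖ad I H (ξ τ)‖ ≤ (‖ad I H‖₊ * B₀.toNNReal : ℝ≥0) :=
      ((ad I H).le_opNorm _).trans
        (mul_le_mul_of_nonneg_left (hB τ (hsub hτ)) (norm_nonneg _))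
    have heq := eqOn_of_hasDerivWithinAt_comp had (fun τ hτ => (hμ τ (hsub hτ)).mono hsub)
      (fun τ hτ => hasDerivWithinAt_comp_Ad I (μ s) (hg τ hτ))
      (by rw [hgs, Ad_one, ContinuousLinearMap.comp_id]) (right_mem_Icc.2 hst)
    rw [heq]
    exact comp_Ad_mem_coadjointOrbit I _ _
  refine isPreconnected_Icc.induction₂ (fun s t => μ t ∈ coadjointOrbit I H (μ s))
    (fun s hs => ?_) (fun _ _ _ _ _ _ => mem_coadjointOrbit_trans)
    (fun _ _ _ _ => mem_coadjointOrbit_symm) (left_mem_Icc.2 hab) (right_mem_Icc.2 hab)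
  filter_upwards [self_mem_nhdsWithin, mem_nhdsWithin_of_mem_nhds (closedBall_mem_nhds s hε)]
    with t ht hts
  rw [mem_closedBall, Real.dist_eq, abs_le] at hts
  rcases le_total s t with hst | hst
  · exact hshort s hs t ht hst hts.2
  · exact mem_coadjointOrbit_symm (hshort t ht s hs hst (by linarith))

end CoadjointOrbit

section ConnectedGroup

theorem mem_submonoid_of_mem_nhds_one {G : Type*} [Group G] [TopologicalSpace G]
    [IsTopologicalGroup G] [ConnectedSpace G] {S : Submonoid G} (hS : (S : Set G) ∈ 𝓝 1) (g : G) :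
    g ∈ S := by
  suffices h : (1 : G)⁻¹ * g ∈ S by simpa only [inv_one, one_mul] using h
  refine PreconnectedSpace.induction₂' (fun x y : G => x⁻¹ * y ∈ S) (fun x => ?_)
    ⟨fun x y z hxy hyz => by simpa only [mul_assoc, mul_inv_cancel_left] using S.mul_mem hxy hyz⟩
    1 g
  have hxy : Tendsto (fun y => x⁻¹ * y) (𝓝 x) (𝓝 1) := by
    simpa only [inv_mul_cancel] using (continuous_const_mul x⁻¹).tendsto x
  have hyx : Tendsto (fun y => y⁻¹ * x) (𝓝 x) (𝓝 1) := by
    simpa only [inv_mul_cancel] using tendsto_inv (x) |>.mul_const x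
  exact (hxy.eventually_mem hS).and (hyx.eventually_mem hS)

theorem eventually_forall_mem_Icc_mul {p : ℝ → Prop} (hp : ∀ᶠ t in 𝓝 0, p t) :
    ∀ᶠ t in 𝓝 0, ∀ σ ∈ Icc (0 : ℝ) 1, p (σ * t) := by
  obtain ⟨ε, hε, hball⟩ := Metric.eventually_nhds_iff_ball.1 hp
  refine Metric.eventually_nhds_iff_ball.2 ⟨ε, hε, fun t ht σ hσ => hball _ ?_⟩
  rw [mem_ball_zero_iff] at ht ⊢
  rw [norm_mul, Real.norm_of_nonneg hσ.1]
  exact (mul_le_of_le_one_left (norm_nonneg t) hσ.2).trans_lt ht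

end ConnectedGroup

section Generation

variable {E : Type*} [NormedAddCommGroup E] [NormedSpace ℝ E]
  {A : Type*} [TopologicalSpace A] (I : ModelWithCorners ℝ E A) [I.Boundaryless]
  {H : Type*} [TopologicalSpace H] [ChartedSpace A H] [Group H] [LieGroup I ∞ H]

/-- The derivatives at `0` of the maps `Φ` from a neighbourhood of `0` in the Lie algebra to a
submonoid `S` of the Lie group, with `Φ 0 = 1`. The map is given in the preferred chart at the
identity. They are closed under addition because `S` is closed under multiplication. -/
def tangentMaps (S : Submonoid H) : AddSubmonoid (E →L[ℝ] E) where
  carrier := {T | ∃ Φ : E → E, Φ 0 = chartOne I H ∧ HasStrictFDerivAt Φ T 0 ∧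
    ∀ᶠ x in 𝓝 0, ofChart I H (Φ x) ∈ S}
  zero_mem' := ⟨fun _ => chartOne I H, rfl, hasStrictFDerivAt_const _ _,
    Eventually.of_forall fun _ => by rw [ofChart_chartOne]; exact S.one_mem⟩
  add_mem' := by
    rintro T T' ⟨Φ, hΦ0, hΦ, hΦS⟩ ⟨Ψ, hΨ0, hΨ, hΨS⟩
    have h0 : (Φ 0, Ψ 0) = (chartOne I H, chartOne I H) := by rw [hΦ0, hΨ0]
    have hpair := hΦ.prodMk hΨ
    refine ⟨fun x => chartMul I H (Φ x, Ψ x), ?_, ?_, ?_⟩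
    · exact (congrArg (chartMul I H) h0).trans (eventually_chartMul_chartOne_right I H).self_of_nhds
    · have hmul : HasStrictFDerivAt (chartMul I H) (fderiv ℝ (chartMul I H)
          (chartOne I H, chartOne I H)) (Φ 0, Ψ 0) := by
        rw [h0]
        exact (contDiffAt_chartMul I H).hasStrictFDerivAt (by simp)
      have hsum : fderiv ℝ (chartMul I H) (chartOne I H, chartOne I H) ∘L T.prod T' = T + T' := by
        ext x
        exact fderiv_chartMul_chartOne I H (T x) (T' x)
      exact hsum ▸ hmul.comp (0 : E) hpair
    · have htendsto : Tendsto (fun x => (Φ x, Ψ x)) (𝓝 0) (𝓝 (chartOne I H, chartOne I H)) :=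
        h0 ▸ hpair.continuousAt.tendsto
      filter_upwards [htendsto.eventually (eventually_ofChart_chartMul I H), hΦS, hΨS]
        with x hx hxΦ hxΨ
      exact hx ▸ S.mul_mem hxΦ hxΨ

variable {I} {S : Submonoid H}

theorem smulRight_mem_tangentMaps {u : ℝ → E} {ξ : E} (hu0 : u 0 = chartOne I H)
    (hu : HasStrictDerivAt u ξ 0) (hS : ∀ᶠ t in 𝓝 0, ofChart I H (u t) ∈ S) (c : E →L[ℝ] ℝ) :
    c.smulRight ξ ∈ tangentMaps I S := by
  have hu' : HasStrictDerivAt u ξ (c 0) := by rwa [map_zero]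
  have hc : Tendsto c (𝓝 0) (𝓝 0) := by simpa only [map_zero] using c.continuous.tendsto 0
  exact ⟨u ∘ c, by rw [Function.comp_apply, map_zero, hu0],
    hu'.hasStrictFDerivAt.comp (0 : E) c.hasStrictFDerivAt, hc.eventually hS⟩

theorem mem_nhds_one_of_id_mem_tangentMaps [CompleteSpace E]
    (hS : ContinuousLinearMap.id ℝ E ∈ tangentMaps I S) : (S : Set H) ∈ 𝓝 1 := by
  obtain ⟨Φ, hΦ0, hΦ, hΦS⟩ := hS
  have hmap := hΦ.map_nhds_eq_of_surj (by simp)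
  have hchart : ∀ᶠ v in 𝓝 (chartOne I H), ofChart I H v ∈ S := by
    rw [← hΦ0, ← hmap]
    exact hΦS
  filter_upwards [(continuousAt_extChartAt (I := I) (1 : H)).eventually hchart,
    extChartAt_source_mem_nhds (I := I) (1 : H)] with g hg hsource
  rwa [ofChart, (extChartAt I (1 : H)).left_inv hsource] at hg

theorem submonoid_mem_nhds_one [FiniteDimensional ℝ E]
    (hS : ∀ ξ : E, ∃ u : ℝ → E, u 0 = chartOne I H ∧ HasStrictDerivAt u ξ 0 ∧
      ∀ᶠ t in 𝓝 0, ofChart I H (u t) ∈ S) : (S : Set H) ∈ 𝓝 1 := by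
  have := FiniteDimensional.complete ℝ E
  let b := Module.finBasis ℝ E
  have hid : ∑ i, (LinearMap.toContinuousLinearMap (b.coord i)).smulRight (b i)
      = ContinuousLinearMap.id ℝ E := by
    ext x
    simp
  refine mem_nhds_one_of_id_mem_tangentMaps (I := I) (hid ▸ sum_mem fun i _ => ?_)
  obtain ⟨u, hu0, hu, huS⟩ := hS (b i)
  exact smulRight_mem_tangentMaps hu0 hu huS _

variable (I H)

theorem exists_chart_flow [CompleteSpace E] (ξ : E) :
    ∃ u : ℝ → E, u 0 = chartOne I H ∧ HasStrictDerivAt u ξ 0 ∧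
      ∀ᶠ t in 𝓝 0, HasDerivAt u (chartLeft I H (u t) ξ) t := by
  have hf : ContDiffAt ℝ 1 (fun u => chartLeft I H u ξ) (chartOne I H) :=
    ((contDiffAt_chartLeft I H).clm_apply contDiffAt_const).of_le (by simp)
  obtain ⟨u, hu0, ε, hε, hu⟩ :=
    hf.exists_forall_mem_closedBall_exists_eq_forall_mem_Ioo_hasDerivAt₀ 0
  have hderiv : ∀ᶠ t in 𝓝 (0 : ℝ), HasDerivAt u (chartLeft I H (u t) ξ) t :=
    eventually_of_mem (Ioo_mem_nhds (by linarith) (by linarith)) hu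
  have hcont : ContinuousAt (fun t => chartLeft I H (u t) ξ) 0 :=
    ContinuousAt.comp (g := fun u => chartLeft I H u ξ) (hu0 ▸ hf.continuousAt)
      hderiv.self_of_nhds.continuousAt
  have hstrict := hasStrictDerivAt_of_hasDerivAt_of_continuousAt hderiv hcont
  rw [hu0, chartLeft_chartOne] at hstrict
  exact ⟨u, hu0, hstrict, hderiv⟩

theorem exists_chart_curve_hasVelocityWithinAt [CompleteSpace E] (ξ : E) :
    ∃ u : ℝ → E, u 0 = chartOne I H ∧ HasStrictDerivAt u ξ 0 ∧
      ∀ᶠ t in 𝓝 0, ∀ σ ∈ Icc (0 : ℝ) 1, HasVelocityWithinAt I (fun σ => ofChart I H (u (σ * t)))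
        (mulInvariantVectorField (I := I) (G := H) (t • ξ) (ofChart I H (u (σ * t))) : E)
        (Icc 0 1) σ := by
  obtain ⟨u, hu0, hu, hflow⟩ := exists_chart_flow I H ξ
  have htarget : ∀ᶠ t in 𝓝 0, u t ∈ (extChartAt I (1 : H)).target :=
    hu.hasDerivAt.continuousAt.eventually_mem (hu0 ▸ target_mem_nhds_chartOne I H)
  refine ⟨u, hu0, hu, (eventually_forall_mem_Icc_mul (hflow.and htarget)).mono
    fun t ht σ hσ => ?_⟩
  have hscaled : HasDerivAt (fun σ => u (σ * t)) (chartLeft I H (u (σ * t)) (t • ξ)) σ := by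
    rw [map_smul]
    simpa only [Function.comp_def, one_mul] using
      (ht σ hσ).1.scomp σ ((hasDerivAt_id' σ).mul_const t)
  exact hasVelocityWithinAt_ofChart_comp I H (ht σ hσ).2 hscaled.hasDerivWithinAt

theorem coadjointOrbit_induction [FiniteDimensional ℝ E] [ConnectedSpace H]
    {R : (E →L[ℝ] ℝ) → (E →L[ℝ] ℝ) → Prop}
    (hrefl : ∀ μ, R μ μ) (htrans : ∀ μ ν κ, R μ ν → R ν κ → R μ κ)
    (hflow : ∀ (ξ : E) (γ : ℝ → E →L[ℝ] ℝ), (∀ t ∈ Icc (0 : ℝ) 1,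
      HasDerivWithinAt γ ((γ t).comp (ad I H ξ)) (Icc 0 1) t) → R (γ 0) (γ 1))
    {μ ν : E →L[ℝ] ℝ} (h : ν ∈ coadjointOrbit I H μ) : R μ ν := by
  have := FiniteDimensional.complete ℝ E
  let S : Submonoid H :=
    { carrier := {g | ∀ μ, R μ (μ.comp (Ad I g))}
      one_mem' := fun μ => by
        rw [Ad_one, ContinuousLinearMap.comp_id]
        exact hrefl μ
      mul_mem' := fun {g k} hg hk μ => by
        rw [Ad_mul, ← ContinuousLinearMap.comp_assoc]
        exact htrans _ _ _ (hg μ) (hk _) }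
  have hS : (S : Set H) ∈ 𝓝 1 := by
    refine submonoid_mem_nhds_one (I := I) fun ξ => ?_
    obtain ⟨u, hu0, hu, hvel⟩ := exists_chart_curve_hasVelocityWithinAt I H ξ
    refine ⟨u, hu0, hu, hvel.mono fun t ht μ => ?_⟩
    simpa only [zero_mul, one_mul, hu0, ofChart_chartOne, Ad_one, ContinuousLinearMap.comp_id]
      using hflow (t • ξ) (fun σ => μ.comp (Ad I (ofChart I H (u (σ * t)))))
        fun σ hσ => hasDerivWithinAt_comp_Ad I μ (ht σ hσ)
  have := topologicalGroup_of_lieGroup I ∞ (G := H)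
  obtain ⟨g, rfl⟩ := h
  exact mem_submonoid_of_mem_nhds_one hS g⁻¹ μ

end Generation

section FunctionalDerivative

variable {E : Type*} [NormedAddCommGroup E] [NormedSpace ℝ E] [FiniteDimensional ℝ E]

theorem apply_funcDeriv (f : (E →L[ℝ] ℝ) → ℝ) (μ ν : E →L[ℝ] ℝ) :
    ν (funcDeriv f μ) = fderiv ℝ f μ ν :=
  congrArg (fun T : (E →L[ℝ] ℝ) →L[ℝ] ℝ => T ν) ((bidual E).apply_symm_apply (fderiv ℝ f μ))

theorem funcDeriv_apply (ξ : E) (μ : E →L[ℝ] ℝ) :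
    funcDeriv (fun ν : E →L[ℝ] ℝ => ν ξ) μ = ξ := by
  rw [funcDeriv, LinearEquiv.symm_apply_eq]
  exact ((ContinuousLinearMap.apply ℝ ℝ ξ).hasFDerivAt (x := μ)).fderiv

theorem funcDeriv_const (c : ℝ) (μ : E →L[ℝ] ℝ) :
    funcDeriv (fun _ : E →L[ℝ] ℝ => c) μ = 0 := by
  rw [funcDeriv, fderiv_fun_const, Pi.zero_apply, map_zero]

theorem continuousAt_funcDeriv {F : Type*} [NormedAddCommGroup F] [NormedSpace ℝ F]
    {C : Type*} [TopologicalSpace C] {J : ModelWithCorners ℝ F C}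
    {P : Type*} [TopologicalSpace P] [ChartedSpace C P] [IsManifold J ∞ P]
    {f : (E →L[ℝ] ℝ) × P → ℝ} {p : (E →L[ℝ] ℝ) × P}
    (hf : ContMDiffAt (𝓘(ℝ, E →L[ℝ] ℝ).prod J) 𝓘(ℝ, ℝ) ∞ f p) :
    ContinuousAt (fun q => funcDeriv (fun μ => f (μ, q.2)) q.1) p := by
  have hswap : ContMDiffAt ((𝓘(ℝ, E →L[ℝ] ℝ).prod J).prod 𝓘(ℝ, E →L[ℝ] ℝ)) 𝓘(ℝ, ℝ) ∞
      (Function.uncurry fun (q : (E →L[ℝ] ℝ) × P) (μ : E →L[ℝ] ℝ) => f (μ, q.2)) (p, p.1) :=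
    ContMDiffAt.comp (g := f) (f := fun z : ((E →L[ℝ] ℝ) × P) × (E →L[ℝ] ℝ) => (z.2, z.1.2))
      (p, p.1) hf (contMDiffAt_snd.prodMk (contMDiffAt_snd.comp _ contMDiffAt_fst))
  have hfderiv := hswap.mfderiv (fun q μ => f (μ, q.2)) Prod.fst contMDiffAt_fst (m := 0) (by simp)
  simp only [inTangentCoordinates_model_space, mfderiv_eq_fderiv] at hfderiv
  exact (bidual E).symm.toLinearMap.continuous_of_finiteDimensional.continuousAt.comp
    hfderiv.continuousAt

end FunctionalDerivative

section UncoupledBracket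

variable {E : Type*} [NormedAddCommGroup E] [NormedSpace ℝ E] [FiniteDimensional ℝ E]
  {A : Type*} [TopologicalSpace A] (I : ModelWithCorners ℝ E A)
  (H : Type*) [TopologicalSpace H] [ChartedSpace A H] [Group H]
  {F : Type*} [NormedAddCommGroup F] [NormedSpace ℝ F] [FiniteDimensional ℝ F]
  {C : Type*} [TopologicalSpace C] {J : ModelWithCorners ℝ F C}
  {P : Type*} [TopologicalSpace P] [ChartedSpace C P] [IsManifold J ∞ P]

/-- The bracket `{·, ·}_Σ` on `𝔥* × P` for `Σ = 0`: the difference of the Lie-Poisson bracket and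
the bracket of the symplectic manifold `P`. -/
def uncoupledBracket (Ω : SymplecticForm J P) (f k : (E →L[ℝ] ℝ) × P → ℝ)
    (z : (E →L[ℝ] ℝ) × P) : ℝ :=
  liePoisson I H (fun μ => f (μ, z.2)) (fun μ => k (μ, z.2)) z.1
    - Ω.bracket (fun x => f (z.1, x)) (fun x => k (z.1, x)) z.2

variable {H} in
theorem naturalBracket_eq_uncoupledBracket (Ω : SymplecticForm J P) {S : E → E → H × P → ℝ}
    (hS : ∀ ξ η x, S ξ η (1, x) = 0) :
    naturalBracket I H Ω S = uncoupledBracket I H Ω := by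
  funext f k z
  rw [naturalBracket, hS, sub_zero, uncoupledBracket]

theorem SymplecticForm.sharp_eq (Ω : SymplecticForm J P) {x : P} {v : F} {α : F →L[ℝ] ℝ}
    (h : (Ω.toFun x v : F →L[ℝ] ℝ) = α) : (Ω.sharp x α : F) = v :=
  (Ω.flat x).symm_apply_eq.2 h.symm

/-- The Hamiltonian vector field `(ad_{δf/δμ}^* μ, -(df|_P)^♯)` of `f` for the bracket
`uncoupledBracket`. -/
def hamiltonianField (Ω : SymplecticForm J P) (f : (E →L[ℝ] ℝ) × P → ℝ)
    (p : (E →L[ℝ] ℝ) × P) : TangentSpace (𝓘(ℝ, E →L[ℝ] ℝ).prod J) p :=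
  ((p.1.comp (ad I H (funcDeriv (fun μ => f (μ, p.2)) p.1)),
    -(Ω.sharp p.2 (mfderiv J 𝓘(ℝ, ℝ) (fun x => f (p.1, x)) p.2) : F)) : (E →L[ℝ] ℝ) × F)

variable [I.Boundaryless] [LieGroup I ∞ H]

theorem liePoisson_eq_fderiv_apply (f k : (E →L[ℝ] ℝ) → ℝ) (μ : E →L[ℝ] ℝ) :
    liePoisson I H f k μ = fderiv ℝ f μ (μ.comp (ad I H (funcDeriv k μ))) := by
  rw [← apply_funcDeriv, liePoisson, lieBr_eq_ad, ad_swap, map_neg, neg_neg,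
    ContinuousLinearMap.comp_apply]

theorem dir_hamiltonianField (Ω : SymplecticForm J P) (f : (E →L[ℝ] ℝ) × P → ℝ)
    {k : (E →L[ℝ] ℝ) × P → ℝ} {p : (E →L[ℝ] ℝ) × P}
    (hk : MDifferentiableAt (𝓘(ℝ, E →L[ℝ] ℝ).prod J) 𝓘(ℝ, ℝ) k p) :
    dir k p (hamiltonianField I H Ω f p) = uncoupledBracket I H Ω k f p := by
  have hsum := mfderiv_prod_eq_add_apply hk (v := hamiltonianField I H Ω f p)
  rw [mfderiv_eq_fderiv] at hsum
  rw [uncoupledBracket, liePoisson_eq_fderiv_apply, sub_eq_add_neg]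
  exact hsum.trans (congrArg _
    (map_neg (mfderiv J 𝓘(ℝ, ℝ) (fun x => k (p.1, x)) p.2 : F →L[ℝ] ℝ) _))

theorem isHamiltonianVectorField_hamiltonianField (Ω : SymplecticForm J P)
    (f : (E →L[ℝ] ℝ) × P → ℝ) (U : Set ((E →L[ℝ] ℝ) × P)) :
    IsHamiltonianVectorField (𝓘(ℝ, E →L[ℝ] ℝ).prod J) (uncoupledBracket I H Ω) f U
      (hamiltonianField I H Ω f) :=
  fun _ _ _ hk => dir_hamiltonianField I H Ω f (hk.mdifferentiableAt (by simp))

variable {I H}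

theorem IsHamiltonianVectorField.fst_eq {Ω : SymplecticForm J P} {f : (E →L[ℝ] ℝ) × P → ℝ}
    {U : Set ((E →L[ℝ] ℝ) × P)}
    {X : ∀ p : (E →L[ℝ] ℝ) × P, TangentSpace (𝓘(ℝ, E →L[ℝ] ℝ).prod J) p}
    (hX : IsHamiltonianVectorField (𝓘(ℝ, E →L[ℝ] ℝ).prod J) (uncoupledBracket I H Ω) f U X)
    {p : (E →L[ℝ] ℝ) × P} (hp : p ∈ U) :
    (show (E →L[ℝ] ℝ) × F from X p).1
      = p.1.comp (ad I H (funcDeriv (fun μ => f (μ, p.2)) p.1)) := by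
  ext η
  have hderiv : HasMFDerivAt (𝓘(ℝ, E →L[ℝ] ℝ).prod J) 𝓘(ℝ, ℝ)
      (fun q : (E →L[ℝ] ℝ) × P => q.1 η) p
      ((ContinuousLinearMap.apply ℝ ℝ η).comp (ContinuousLinearMap.fst ℝ (E →L[ℝ] ℝ) F)) :=
    ((ContinuousLinearMap.apply ℝ ℝ η).hasMFDerivAt (x := p.1)).comp p (hasMFDerivAt_fst p)
  have hsmooth : ContMDiffAt (𝓘(ℝ, E →L[ℝ] ℝ).prod J) 𝓘(ℝ, ℝ) ∞
      (fun q : (E →L[ℝ] ℝ) × P => q.1 η) p :=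
    (ContinuousLinearMap.apply ℝ ℝ η).contMDiff.contMDiffAt.comp p contMDiffAt_fst
  have hdir := (hX p hp _ hsmooth).trans
    (dir_hamiltonianField I H Ω f hderiv.mdifferentiableAt).symm
  unfold dir at hdir
  rwa [hderiv.mfderiv] at hdir

theorem HamiltonianSegment.fst_mem_coadjointOrbit {Ω : SymplecticForm J P}
    {p q : (E →L[ℝ] ℝ) × P}
    (h : HamiltonianSegment (𝓘(ℝ, E →L[ℝ] ℝ).prod J) (uncoupledBracket I H Ω) p q) :
    q.1 ∈ coadjointOrbit I H p.1 := by
  obtain ⟨U, f, X, γ, a, b, hU, hf, hX, hab, hγU, hγ, rfl, rfl⟩ := h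
  refine mem_coadjointOrbit_of_hasDerivWithinAt I H (μ := fun t => (γ t).1)
    (ξ := fun t => funcDeriv (fun μ => f (μ, (γ t).2)) (γ t).1) hab (fun t ht => ?_) fun t ht => ?_
  · exact (continuousAt_funcDeriv (hf.contMDiffAt (hU.mem_nhds (hγU ht)))).comp_continuousWithinAt
      (hγ t ht).continuousWithinAt
  · rw [← hX.fst_eq (hγU ht), ← hasVelocityWithinAt_iff_hasDerivWithinAt]
    exact HasVelocityWithinAt.fst (isMIntegralCurveOn_iff_forall_hasVelocityWithinAt.1 hγ t ht)

variable (I H)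

theorem hamiltonianSegment_of_hasVelocityWithinAt (Ω : SymplecticForm J P)
    {U : Set ((E →L[ℝ] ℝ) × P)} {f : (E →L[ℝ] ℝ) × P → ℝ} (hU : IsOpen U)
    (hf : ContMDiffOn (𝓘(ℝ, E →L[ℝ] ℝ).prod J) 𝓘(ℝ, ℝ) ∞ f U)
    {μ : ℝ → E →L[ℝ] ℝ} {c : ℝ → P} {v : ℝ → F}
    (hmem : ∀ t ∈ Icc (0 : ℝ) 1, (μ t, c t) ∈ U)
    (hμ : ∀ t ∈ Icc (0 : ℝ) 1, HasDerivWithinAt μ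
      ((μ t).comp (ad I H (funcDeriv (fun ν => f (ν, c t)) (μ t)))) (Icc 0 1) t)
    (hc : ∀ t ∈ Icc (0 : ℝ) 1, HasVelocityWithinAt J c (v t) (Icc 0 1) t)
    (hv : ∀ t ∈ Icc (0 : ℝ) 1, (Ω.toFun (c t) (-v t : F) : F →L[ℝ] ℝ)
      = mfderiv J 𝓘(ℝ, ℝ) (fun x => f (μ t, x)) (c t)) :
    HamiltonianSegment (𝓘(ℝ, E →L[ℝ] ℝ).prod J) (uncoupledBracket I H Ω) (μ 0, c 0) (μ 1, c 1) := by
  refine ⟨U, f, hamiltonianField I H Ω f, fun t => (μ t, c t), 0, 1, hU, hf,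
    isHamiltonianVectorField_hamiltonianField I H Ω _ _, zero_le_one, hmem, fun t ht => ?_,
    rfl, rfl⟩
  have hfield : (hamiltonianField I H Ω f (μ t, c t) : (E →L[ℝ] ℝ) × F)
      = ((μ t).comp (ad I H (funcDeriv (fun ν => f (ν, c t)) (μ t))), v t) :=
    Prod.ext rfl ((congrArg Neg.neg (Ω.sharp_eq (hv t ht))).trans (neg_neg (v t)))
  exact hfield ▸ (hasVelocityWithinAt_iff_hasDerivWithinAt.2 (hμ t ht)).prodMk (hc t ht)

theorem hamiltonianSegment_coadjoint (Ω : SymplecticForm J P) {ξ : E} {μ : ℝ → E →L[ℝ] ℝ}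
    (hμ : ∀ t ∈ Icc (0 : ℝ) 1, HasDerivWithinAt μ ((μ t).comp (ad I H ξ)) (Icc 0 1) t) (x : P) :
    HamiltonianSegment (𝓘(ℝ, E →L[ℝ] ℝ).prod J) (uncoupledBracket I H Ω) (μ 0, x) (μ 1, x) := by
  refine hamiltonianSegment_of_hasVelocityWithinAt I H Ω (f := fun q => q.1 ξ)
    (c := fun _ => x) (v := fun _ => 0) isOpen_univ
    ((ContinuousLinearMap.apply ℝ ℝ ξ).contMDiff.comp contMDiff_fst).contMDiffOn
    (fun _ _ => mem_univ _) (fun t ht => ?_) (fun _ _ => hasVelocityWithinAt_const x)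
    (fun t _ => ?_)
  · rw [funcDeriv_apply]
    exact hμ t ht
  · have hconst : (mfderiv J 𝓘(ℝ, ℝ) (fun _ : P => μ t ξ) x : F →L[ℝ] ℝ) = 0 := mfderiv_const
    exact ((congrArg (Ω.toFun x : F →L[ℝ] F →L[ℝ] ℝ) neg_zero).trans (map_zero _)).trans hconst.symm

theorem hamiltonianSegment_of_hasVelocityWithinAt_snd (Ω : SymplecticForm J P) {V : Set P}
    {f : P → ℝ} (hV : IsOpen V) (hf : ContMDiffOn J 𝓘(ℝ, ℝ) ∞ f V) (μ : E →L[ℝ] ℝ)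
    {c : ℝ → P} {v : ℝ → F} (hmem : ∀ t ∈ Icc (0 : ℝ) 1, c t ∈ V)
    (hc : ∀ t ∈ Icc (0 : ℝ) 1, HasVelocityWithinAt J c (v t) (Icc 0 1) t)
    (hv : ∀ t ∈ Icc (0 : ℝ) 1,
      (Ω.toFun (c t) (-v t : F) : F →L[ℝ] ℝ) = mfderiv J 𝓘(ℝ, ℝ) f (c t)) :
    HamiltonianSegment (𝓘(ℝ, E →L[ℝ] ℝ).prod J) (uncoupledBracket I H Ω) (μ, c 0) (μ, c 1) := by
  refine hamiltonianSegment_of_hasVelocityWithinAt I H Ω (f := fun q => f q.2)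
    (isOpen_univ.prod hV) (hf.comp contMDiffOn_snd fun _ hq => hq.2) (μ := fun _ => μ)
    (fun t ht => ⟨mem_univ _, hmem t ht⟩) (fun t _ => ?_) hc hv
  have hzero : μ.comp (ad I H (funcDeriv (fun _ => f (c t)) μ)) = 0 := by
    rw [funcDeriv_const, map_zero, ContinuousLinearMap.comp_zero]
  exact hzero ▸ hasDerivWithinAt_const t _ μ

end UncoupledBracket

section ChartTrajectory

theorem exists_hasFDerivAt_along_line {F : Type*} [NormedAddCommGroup F] [NormedSpace ℝ F]
    {T : Set F} (hT : IsOpen T) {α : F → F →L[ℝ] ℝ} (hα : ContDiffOn ℝ ∞ α T) {v : F}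
    (hαv : ∀ u ∈ T, α u v = 0) (u₀ : F) :
    ∃ (U : Set F) (h : F → ℝ), IsOpen U ∧ ContDiffOn ℝ ∞ h U ∧ ∀ t : ℝ, u₀ + t • v ∈ T →
      u₀ + t • v ∈ U ∧ HasFDerivAt h (α (u₀ + t • v)) (u₀ + t • v) := by
  obtain ⟨ℓ, hℓ⟩ : ∃ ℓ : StrongDual ℝ F, ℓ v • v = v := by
    rcases eq_or_ne v 0 with rfl | hv
    · exact ⟨0, smul_zero _⟩
    · obtain ⟨ℓ, hℓ⟩ := SeparatingDual.exists_eq_one (R := ℝ) hv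
      exact ⟨ℓ, by rw [hℓ, one_smul]⟩
  -- `r` projects onto the line, and `h u = α (r u) (u - u₀)` is the primitive: its `α'`-term
  -- vanishes on the line because `α · v` is constant.
  let r : F → F := fun u => u₀ + ℓ (u - u₀) • v
  have hr : ContDiff ℝ ∞ r := by fun_prop
  have hU : IsOpen (r ⁻¹' T) := hT.preimage hr.continuous
  have hαr : ContDiffOn ℝ ∞ (fun u => α (r u)) (r ⁻¹' T) := hα.comp hr.contDiffOn fun _ h => h
  refine ⟨r ⁻¹' T, fun u => α (r u) (u - u₀), hU, hαr.clm_apply (by fun_prop), fun t ht => ?_⟩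
  have hrt : r (u₀ + t • v) = u₀ + t • v := by
    simp only [r, add_sub_cancel_left, map_smul, smul_assoc, hℓ]
  have hmem : u₀ + t • v ∈ r ⁻¹' T := by rwa [mem_preimage, hrt]
  obtain ⟨α', hα'⟩ := (hαr.contDiffAt (hU.mem_nhds hmem)).differentiableAt (by simp)
  have hα'v (w : F) : α' w v = 0 := by
    have hzero : HasFDerivAt (fun u => α (r u) v) (0 : F →L[ℝ] ℝ) (u₀ + t • v) :=
      (hasFDerivAt_const (0 : ℝ) _).congr_of_eventuallyEq
        (eventually_of_mem (hU.mem_nhds hmem) fun u hu => hαv _ hu)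
    simpa using (congrArg (fun S : F →L[ℝ] ℝ => S w)
      (hzero.unique (hα'.clm_apply (hasFDerivAt_const v _)))).symm
  refine ⟨hmem, (hα'.clm_apply ((hasFDerivAt_id _).sub_const u₀)).congr_fderiv ?_⟩
  ext w
  simp [hrt, hα'v]

variable {F : Type*} [NormedAddCommGroup F] [NormedSpace ℝ F]
  {C : Type*} [TopologicalSpace C] {J : ModelWithCorners ℝ F C}
  {P : Type*} [TopologicalSpace P] [ChartedSpace C P] [IsManifold J ∞ P]

/-- The covector field `-Ω(v, ·)`, for a constant vector `v`, in the coordinates of the chart at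
`y`: the differential that a Hamiltonian function must have at the points where `v` is to be the
velocity of a trajectory. -/
def chartCovector (Ω : TwoForm J P) (y : P) (v u : F) : F →L[ℝ] ℝ :=
  -((Ω.toFun ((extChartAt J y).symm u) : F →L[ℝ] F →L[ℝ] ℝ)
      (mfderiv 𝓘(ℝ, F) J (extChartAt J y).symm u v)).comp
    (mfderiv 𝓘(ℝ, F) J (extChartAt J y).symm u : F →L[ℝ] F)

theorem chartCovector_apply_self (Ω : TwoForm J P) (y : P) (v u : F) :
    chartCovector Ω y v u v = 0 :=
  neg_eq_zero.2 (Ω.alternating _ (mfderiv 𝓘(ℝ, F) J (extChartAt J y).symm u v))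

variable [J.Boundaryless]

theorem contMDiffAt_mfderiv_extChartAt_symm {y : P} {u : F} (hu : u ∈ (extChartAt J y).target)
    (v : F) :
    ContMDiffAt 𝓘(ℝ, F) J.tangent ∞ (fun u => (Bundle.TotalSpace.mk' F ((extChartAt J y).symm u)
      (mfderiv 𝓘(ℝ, F) J (extChartAt J y).symm u v) : TangentBundle J P)) u := by
  have hT := isOpen_extChartAt_target (I := J) y
  have htangent := (contMDiffOn_extChartAt_symm (I := J) (n := ∞) y).contMDiffOn_tangentMapWithin
    (m := ∞) (by simp) hT.uniqueMDiffOn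
  have hconst : ContMDiffAt 𝓘(ℝ, F) 𝓘(ℝ, F).tangent ∞
      (fun u : F => (Bundle.TotalSpace.mk' F u v : TangentBundle 𝓘(ℝ, F) F)) u :=
    contMDiffAt_vectorSpace_iff_contDiffAt.2 contDiffAt_const
  have hcomp := (ContMDiffWithinAt.comp u (htangent ⟨u, v⟩ hu) hconst.contMDiffWithinAt
    (s := (extChartAt J y).target) fun w hw => hw).contMDiffAt (hT.mem_nhds hu)
  refine hcomp.congr_of_eventuallyEq (eventually_of_mem (hT.mem_nhds hu) fun w hw => ?_)
  simp only [Function.comp, tangentMapWithin, mfderivWithin_of_isOpen hT hw]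

theorem contDiffOn_chartCovector [FiniteDimensional ℝ F] (Ω : TwoForm J P) (y : P) (v : F) :
    ContDiffOn ℝ ∞ (chartCovector Ω y v) (extChartAt J y).target := by
  rw [contDiffOn_clm_apply]
  refine fun w => ContDiffOn.neg fun u hu => ContDiffAt.contDiffWithinAt ?_
  have h : ContMDiffAt 𝓘(ℝ, F) (J.prod 𝓘(ℝ)) ∞ (fun u : F => Bundle.TotalSpace.mk' ℝ
      (E := Bundle.Trivial P ℝ) ((extChartAt J y).symm u) (Ω.toFun ((extChartAt J y).symm u)
        (mfderiv 𝓘(ℝ, F) J (extChartAt J y).symm u v)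
        (mfderiv 𝓘(ℝ, F) J (extChartAt J y).symm u w))) u :=
    ContMDiffAt.clm_bundle_apply₂ (F₁ := F) (F₂ := F)
      (Ω.smooth.contMDiffAt.comp u (contMDiffAt_extChartAt_symm hu))
      (contMDiffAt_mfderiv_extChartAt_symm hu v) (contMDiffAt_mfderiv_extChartAt_symm hu w)
  simp only [Bundle.contMDiffAt_totalSpace] at h
  exact h.2.contDiffAt

theorem TwoForm.apply_neg_eq_mfderiv (Ω : TwoForm J P) {y : P} {v u : F} {h : F → ℝ}
    (hu : u ∈ (extChartAt J y).target) (hh : HasFDerivAt h (chartCovector Ω y v u) u) :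
    (Ω.toFun ((extChartAt J y).symm u)
      (-(mfderiv 𝓘(ℝ, F) J (extChartAt J y).symm u v : F) : F) : F →L[ℝ] ℝ)
      = mfderiv J 𝓘(ℝ, ℝ) (fun x => h (extChartAt J y x)) ((extChartAt J y).symm u) := by
  let D : F →L[ℝ] F := mfderiv 𝓘(ℝ, F) J (extChartAt J y).symm u
  let B : F →L[ℝ] F →L[ℝ] ℝ := Ω.toFun ((extChartAt J y).symm u)
  have hsource : (extChartAt J y).symm u ∈ (chartAt C y).source := by
    rw [← extChartAt_source J]
    exact (extChartAt J y).map_target hu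
  have hderiv : HasMFDerivAt 𝓘(ℝ, F) 𝓘(ℝ, ℝ) h (extChartAt J y ((extChartAt J y).symm u))
      (-(B (D v)).comp D : F →L[ℝ] ℝ) := by
    rw [(extChartAt J y).right_inv hu]
    exact HasFDerivAt.hasMFDerivAt (f := h) hh
  refine Eq.trans ?_
    (hderiv.comp _ (mdifferentiableAt_extChartAt (I := J) hsource).hasMFDerivAt).mfderiv.symm
  calc B (-D v) = (-B (D v)).comp (ContinuousLinearMap.id ℝ F) := by
        rw [map_neg, ContinuousLinearMap.comp_id]
    _ = _ := congrArg (fun T : F →L[ℝ] F => (-B (D v)).comp T)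
        (mfderiv_extChartAt_symm_comp_mfderiv_extChartAt hu).symm

theorem hasVelocityWithinAt_extChartAt_symm_line {y : P} {u₀ v : F} {s : Set ℝ} {t : ℝ}
    (hu : u₀ + t • v ∈ (extChartAt J y).target) :
    HasVelocityWithinAt J (fun t : ℝ => (extChartAt J y).symm (u₀ + t • v))
      (mfderiv 𝓘(ℝ, F) J (extChartAt J y).symm (u₀ + t • v) v) s t := by
  have hline : HasDerivWithinAt (fun t : ℝ => u₀ + t • v) v s t := by
    simpa only [one_smul] using
      (((hasDerivAt_id' t).smul_const v).const_add u₀).hasDerivWithinAt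
  exact (hasVelocityWithinAt_iff_hasDerivWithinAt.2 hline).comp_hasMFDerivAt
    ((contMDiffAt_extChartAt_symm hu).mdifferentiableAt (by simp)).hasMFDerivAt

theorem exists_hamiltonian_extChartAt_symm_line [FiniteDimensional ℝ F] (Ω : TwoForm J P)
    (y : P) (u₀ v : F) :
    ∃ (V : Set P) (f : P → ℝ), IsOpen V ∧ ContMDiffOn J 𝓘(ℝ, ℝ) ∞ f V ∧
      ∀ t : ℝ, u₀ + t • v ∈ (extChartAt J y).target →
        (extChartAt J y).symm (u₀ + t • v) ∈ V ∧
        (Ω.toFun ((extChartAt J y).symm (u₀ + t • v))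
          (-(mfderiv 𝓘(ℝ, F) J (extChartAt J y).symm (u₀ + t • v) v : F) : F) : F →L[ℝ] ℝ)
          = mfderiv J 𝓘(ℝ, ℝ) f ((extChartAt J y).symm (u₀ + t • v)) := by
  obtain ⟨U, h, hU, hh, hprim⟩ := exists_hasFDerivAt_along_line (isOpen_extChartAt_target y)
    (contDiffOn_chartCovector Ω y v) (fun u _ => chartCovector_apply_self Ω y v u) u₀
  refine ⟨(extChartAt J y).source ∩ extChartAt J y ⁻¹' U, fun x => h (extChartAt J y x),
    (continuousOn_extChartAt y).isOpen_inter_preimage (isOpen_extChartAt_source y) hU,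
    hh.contMDiffOn.comp (contMDiffOn_extChartAt.mono fun x hx => ?_) fun x hx => hx.2,
    fun t ht => ⟨⟨(extChartAt J y).map_target ht, ?_⟩,
      Ω.apply_neg_eq_mfderiv ht (hprim t ht).2⟩⟩
  · rw [← extChartAt_source J]
    exact hx.1
  · rw [mem_preimage, (extChartAt J y).right_inv ht]
    exact (hprim t ht).1

end ChartTrajectory

section Leaves

variable {E : Type*} [NormedAddCommGroup E] [NormedSpace ℝ E] [FiniteDimensional ℝ E]
  {A : Type*} [TopologicalSpace A] (I : ModelWithCorners ℝ E A) [I.Boundaryless]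
  (H : Type*) [TopologicalSpace H] [ChartedSpace A H] [Group H] [LieGroup I ∞ H]
  {F : Type*} [NormedAddCommGroup F] [NormedSpace ℝ F] [FiniteDimensional ℝ F]
  {C : Type*} [TopologicalSpace C] {J : ModelWithCorners ℝ F C} [J.Boundaryless]
  {P : Type*} [TopologicalSpace P] [ChartedSpace C P] [IsManifold J ∞ P]

theorem hamiltonianSegment_extChartAt_symm (Ω : SymplecticForm J P) (μ : E →L[ℝ] ℝ) (y : P)
    {u₀ u₁ : F} (hseg : ∀ t ∈ Icc (0 : ℝ) 1, u₀ + t • (u₁ - u₀) ∈ (extChartAt J y).target) :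
    HamiltonianSegment (𝓘(ℝ, E →L[ℝ] ℝ).prod J) (uncoupledBracket I H Ω)
      (μ, (extChartAt J y).symm u₀) (μ, (extChartAt J y).symm u₁) := by
  obtain ⟨V, f, hV, hf, hVf⟩ := exists_hamiltonian_extChartAt_symm_line Ω.toTwoForm y u₀ (u₁ - u₀)
  simpa only [zero_smul, add_zero, one_smul, add_sub_cancel] using
    hamiltonianSegment_of_hasVelocityWithinAt_snd I H Ω hV hf μ
      (c := fun t => (extChartAt J y).symm (u₀ + t • (u₁ - u₀)))
      (fun t ht => (hVf t (hseg t ht)).1)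
      (fun t ht => hasVelocityWithinAt_extChartAt_symm_line (hseg t ht))
      (fun t ht => (hVf t (hseg t ht)).2)

theorem eventually_hamiltonianSegment_snd (Ω : SymplecticForm J P) (μ : E →L[ℝ] ℝ) (x : P) :
    ∀ᶠ y in 𝓝 x,
      HamiltonianSegment (𝓘(ℝ, E →L[ℝ] ℝ).prod J) (uncoupledBracket I H Ω) (μ, x) (μ, y) ∧
      HamiltonianSegment (𝓘(ℝ, E →L[ℝ] ℝ).prod J) (uncoupledBracket I H Ω) (μ, y) (μ, x) := by
  obtain ⟨ε, hε, hball⟩ := Metric.mem_nhds_iff.1 (extChartAt_target_mem_nhds (I := J) x)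
  have hjoin {y z : P} (hy : y ∈ (extChartAt J x).source) (hz : z ∈ (extChartAt J x).source)
      (hyε : extChartAt J x y ∈ Metric.ball (extChartAt J x x) ε)
      (hzε : extChartAt J x z ∈ Metric.ball (extChartAt J x x) ε) :
      HamiltonianSegment (𝓘(ℝ, E →L[ℝ] ℝ).prod J) (uncoupledBracket I H Ω) (μ, y) (μ, z) := by
    have h := hamiltonianSegment_extChartAt_symm I H Ω μ x fun t ht =>
      hball ((convex_ball _ _).add_smul_sub_mem hyε hzε ht)
    rwa [(extChartAt J x).left_inv hy, (extChartAt J x).left_inv hz] at h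
  have hx := mem_extChartAt_source (I := J) x
  have hxε := Metric.mem_ball_self (x := extChartAt J x x) hε
  filter_upwards [extChartAt_source_mem_nhds (I := J) x,
    (continuousAt_extChartAt (I := J) x).preimage_mem_nhds (Metric.ball_mem_nhds _ hε)]
    with y hy hyε
  exact ⟨hjoin hx hy hxε hyε, hjoin hy hx hyε hxε⟩

theorem mk_mem_symplecticLeaf_uncoupledBracket [ConnectedSpace P] (Ω : SymplecticForm J P)
    (μ : E →L[ℝ] ℝ) (x y : P) :
    (μ, y) ∈ symplecticLeaf (𝓘(ℝ, E →L[ℝ] ℝ).prod J) (uncoupledBracket I H Ω) (μ, x) :=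
  PreconnectedSpace.induction₂'
    (fun x y => Relation.ReflTransGen
      (HamiltonianSegment (𝓘(ℝ, E →L[ℝ] ℝ).prod J) (uncoupledBracket I H Ω)) (μ, x) (μ, y))
    (fun x => (eventually_hamiltonianSegment_snd I H Ω μ x).mono
      fun _ h => ⟨.single h.1, .single h.2⟩)
    ⟨fun _ _ _ => Relation.ReflTransGen.trans⟩ x y

theorem symplecticLeaf_uncoupledBracket [ConnectedSpace H] [ConnectedSpace P]
    (Ω : SymplecticForm J P) (μ : E →L[ℝ] ℝ) (x : P) :
    symplecticLeaf (𝓘(ℝ, E →L[ℝ] ℝ).prod J) (uncoupledBracket I H Ω) (μ, x)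
      = coadjointOrbit I H μ ×ˢ univ := by
  apply Subset.antisymm
  · intro q hq
    refine ⟨?_, mem_univ _⟩
    induction hq with
    | refl => exact mem_coadjointOrbit_self I H μ
    | tail _ h ih => exact mem_coadjointOrbit_trans ih h.fst_mem_coadjointOrbit
  · rintro ⟨ν, y⟩ ⟨hν, -⟩
    exact (mk_mem_symplecticLeaf_uncoupledBracket I H Ω μ x y).trans
      (coadjointOrbit_induction I H
        (R := fun ν κ => (κ, y) ∈
          symplecticLeaf (𝓘(ℝ, E →L[ℝ] ℝ).prod J) (uncoupledBracket I H Ω) (ν, y))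
        (fun _ => .refl) (fun _ _ _ => .trans)
        (fun _ _ hγ => .single (hamiltonianSegment_coadjoint I H Ω hγ y)) hν)

theorem symplecticLeaves_uncoupledBracket [ConnectedSpace H] [ConnectedSpace P]
    (Ω : SymplecticForm J P) :
    symplecticLeaves (𝓘(ℝ, E →L[ℝ] ℝ).prod J) (uncoupledBracket I H Ω)
      = (· ×ˢ univ) '' range (coadjointOrbit I H) := by
  ext L
  simp only [symplecticLeaves, ← range_comp, mem_range, Prod.exists,
    symplecticLeaf_uncoupledBracket, exists_const, Function.comp_apply]

end Leaves

namespace SE2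

open ComplexConjugate

/-- The rotational component of `eΩ`: the velocity of `t ↦ exp (i t)` at `t = 0`, in the tangent
model of the circle. It is left abstract, as it depends on Mathlib's choice of charts. -/
def circleVec : EuclideanSpace ℝ (Fin 1) :=
  mfderiv 𝓘(ℝ, ℝ) (𝓡 1) (fun t : ℝ => Circle.exp t) 0 (1 : ℝ)

theorem hasVelocityWithinAt_circleExp :
    HasVelocityWithinAt (𝓡 1) (fun t : ℝ => Circle.exp t) circleVec univ 0 :=
  hasVelocityWithinAt_mfderiv ((contMDiff_circleExp (m := 1)).mdifferentiable (by simp) 0)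

theorem hasDerivAt_circleExp_coe :
    HasDerivAt (fun t : ℝ => ((Circle.exp t : Circle) : ℂ)) Complex.I 0 := by
  have h : HasDerivAt (fun t : ℝ => (t : ℂ) * Complex.I) Complex.I 0 := by
    simpa using (Complex.ofRealCLM.hasDerivAt (x := (0 : ℝ))).mul_const Complex.I
  simpa [Circle.coe_exp] using h.cexp

theorem circleVec_ne_zero : circleVec ≠ 0 := by
  intro h
  have hcoe : MDifferentiableAt (𝓡 1) 𝓘(ℝ, ℂ) (fun z : Circle => (z : ℂ)) (Circle.exp 0) :=
    contMDiff_coe.mdifferentiable (by simp) _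
  have hderiv : HasDerivAt (fun t : ℝ => ((Circle.exp t : Circle) : ℂ)) _ 0 :=
    hasDerivWithinAt_univ.1 (hasVelocityWithinAt_iff_hasDerivWithinAt.1
      (hasVelocityWithinAt_circleExp.comp_hasMFDerivAt hcoe.hasMFDerivAt))
  have hI := hderiv.unique hasDerivAt_circleExp_coe
  rw [h] at hI
  exact Complex.I_ne_zero (hI.symm.trans (map_zero _))

theorem circleVec_apply_zero_ne_zero : circleVec 0 ≠ 0 := fun h =>
  circleVec_ne_zero (by ext i; rw [Subsingleton.elim i 0, h]; rfl)

theorem hasVelocityWithinAt_translation (w : ℂ) :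
    HasVelocityWithinAt 𝓘SE (fun t : ℝ => ((1, (t : ℂ) * w) : SE2)) ((0, w) : Model) univ 0 :=
  (hasVelocityWithinAt_const (1 : Circle)).prodMk
    (hasVelocityWithinAt_iff_hasDerivWithinAt.2 (hasDerivWithinAt_univ.2
      (by simpa using (Complex.ofRealCLM.hasDerivAt (x := (0 : ℝ))).mul_const w)))

theorem hasVelocityWithinAt_rotation {z : ℝ → ℂ} {z' : ℂ} (hz : HasDerivAt z z' 0) :
    HasVelocityWithinAt 𝓘SE (fun t : ℝ => ((Circle.exp t, z t) : SE2))
      ((circleVec, z') : Model) univ 0 :=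
  hasVelocityWithinAt_circleExp.prodMk
    (hasVelocityWithinAt_iff_hasDerivWithinAt.2 (hasDerivWithinAt_univ.2 hz))

theorem ex_eq : ex = (0, 1) := by
  have h := hasVelocityWithinAt_translation 1
  simp only [mul_one] at h
  exact h.mfderiv_eq

theorem ey_eq : ey = (0, Complex.I) :=
  (hasVelocityWithinAt_translation Complex.I).mfderiv_eq

theorem eΩ_eq : eΩ = (circleVec, 0) :=
  (hasVelocityWithinAt_rotation (hasDerivAt_const (0 : ℝ) (0 : ℂ))).mfderiv_eq

theorem conj_eq (g h : SE2) :
    g * h * g⁻¹ = ((h.1, (g.1 : ℂ) * h.2 + (1 - (h.1 : ℂ)) * g.2) : SE2) := by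
  refine Prod.ext (mul_inv_cancel_comm g.1 h.1) ?_
  change ((g.1 * h.1 : Circle) : ℂ) * (-(((g.1⁻¹ : Circle) : ℂ) * g.2)) + (g.1 * h.2 + g.2) = _
  have : (g.1 : ℂ) ≠ 0 := Circle.coe_ne_zero g.1
  push_cast
  field_simp
  ring

theorem Ad_translation (g : SE2) (w : ℂ) :
    (Ad 𝓘SE g : Model →L[ℝ] Model) (0, w) = (0, (g.1 : ℂ) * w) := by
  let γ : ℝ → SE2 := fun t => (1, (t : ℂ) * w)
  have hγ : (fun t => g * γ t * g⁻¹)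
      = fun t : ℝ => ((1, (t : ℂ) * ((g.1 : ℂ) * w)) : SE2) := by
    funext t
    rw [conj_eq]
    exact Prod.ext rfl (by simp [γ]; ring)
  refine Ad_apply_eq_of_hasVelocityWithinAt 𝓘SE (γ := γ) (Prod.ext rfl (by simp [γ]; rfl))
    (hasVelocityWithinAt_translation w) ?_
  rw [hγ]
  exact hasVelocityWithinAt_translation _

theorem Ad_eΩ (g : SE2) :
    (Ad 𝓘SE g : Model →L[ℝ] Model) eΩ = (circleVec, -(Complex.I * g.2)) := by
  let γ : ℝ → SE2 := fun t => (Circle.exp t, 0)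
  have hγ : (fun t => g * γ t * g⁻¹)
      = fun t : ℝ => ((Circle.exp t, (1 - ((Circle.exp t : Circle) : ℂ)) * g.2) : SE2) := by
    funext t
    rw [conj_eq]
    exact Prod.ext rfl (by simp [γ])
  rw [eΩ_eq]
  refine Ad_apply_eq_of_hasVelocityWithinAt 𝓘SE (γ := γ) (Prod.ext Circle.exp_zero rfl)
    (hasVelocityWithinAt_rotation (hasDerivAt_const (0 : ℝ) (0 : ℂ))) ?_
  rw [hγ]
  exact hasVelocityWithinAt_rotation
    (by simpa using (hasDerivAt_circleExp_coe.const_sub 1).mul_const g.2)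

/-- The linear momentum `Π_x + i Π_y`: the two translational coordinates of a point of `𝔰𝔢(2)*` as
one complex number, on which the rotations of the plane act by multiplication. -/
def linearMomentum (μ : Model →L[ℝ] ℝ) : ℂ := ⟨μ ex, μ ey⟩

theorem apply_translation (μ : Model →L[ℝ] ℝ) (w : ℂ) :
    μ (0, w) = (w * conj (linearMomentum μ)).re := by
  have hw : ((0, w) : Model) = w.re • ex + w.im • ey := by
    rw [ex_eq, ey_eq]
    refine Prod.ext (by simp) (Complex.ext ?_ ?_) <;> simp
  rw [hw]
  simp [linearMomentum]

theorem linearMomentum_comp_Ad (μ : Model →L[ℝ] ℝ) (g : SE2) :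
    linearMomentum (μ.comp (Ad 𝓘SE g)) = ((g.1⁻¹ : Circle) : ℂ) * linearMomentum μ := by
  refine Complex.ext ?_ ?_
  · change μ ((Ad 𝓘SE g : Model →L[ℝ] Model) ex) = _
    rw [ex_eq, Ad_translation, apply_translation, Circle.coe_inv_eq_conj]
    simp
  · change μ ((Ad 𝓘SE g : Model →L[ℝ] Model) ey) = _
    rw [ey_eq, Ad_translation, apply_translation, Circle.coe_inv_eq_conj]
    simp
    ring

theorem comp_Ad_apply_eΩ (μ : Model →L[ℝ] ℝ) (g : SE2) :
    μ.comp (Ad 𝓘SE g) eΩ = μ eΩ + (g.2 * conj (linearMomentum μ)).im := by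
  have hsplit : ((circleVec, -(Complex.I * g.2)) : Model)
      = eΩ + ((0, -(Complex.I * g.2)) : Model) := by
    rw [eΩ_eq, Prod.mk_add_mk, add_zero, zero_add]
  rw [ContinuousLinearMap.comp_apply, Ad_eΩ, hsplit, map_add, apply_translation]
  simp

theorem ext_linearMomentum {μ ν : Model →L[ℝ] ℝ} (hlin : linearMomentum μ = linearMomentum ν)
    (hang : μ eΩ = ν eΩ) : μ = ν := by
  refine ContinuousLinearMap.ext fun v => ?_
  have hv : v = (v.1 0 / circleVec 0) • eΩ + ((0, v.2) : Model) := by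
    rw [eΩ_eq]
    refine Prod.ext ?_ (by simp)
    ext i
    rw [Subsingleton.elim i 0]
    simp [circleVec_apply_zero_ne_zero]
  rw [hv, map_add, map_add, map_smul, map_smul, apply_translation, apply_translation, hlin, hang]

theorem exists_linearMomentum_eq (m : ℂ) (c : ℝ) :
    ∃ μ : Model →L[ℝ] ℝ, linearMomentum μ = m ∧ μ eΩ = c := by
  refine ⟨(innerSL ℝ m).comp (ContinuousLinearMap.snd ℝ (EuclideanSpace ℝ (Fin 1)) ℂ)
    + (c / circleVec 0) • (EuclideanSpace.proj (0 : Fin 1)).comp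
      (ContinuousLinearMap.fst ℝ (EuclideanSpace ℝ (Fin 1)) ℂ), Complex.ext ?_ ?_, ?_⟩
  · simp [linearMomentum, ex_eq]
  · simp [linearMomentum, ey_eq]
  · simp [eΩ_eq, circleVec_apply_zero_ne_zero]

theorem mem_coadjointOrbit_iff {μ ν : Model →L[ℝ] ℝ} :
    ν ∈ coadjointOrbit 𝓘SE SE2 μ ↔ ∃ (z : Circle) (w : ℂ),
      linearMomentum ν = z * linearMomentum μ ∧
        ν eΩ = μ eΩ + (w * conj (linearMomentum μ)).im := by
  constructor
  · rintro ⟨g, rfl⟩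
    exact ⟨_, _, linearMomentum_comp_Ad μ g⁻¹, comp_Ad_apply_eΩ μ g⁻¹⟩
  · rintro ⟨z, w, hlin, hang⟩
    let g : SE2 := (z⁻¹, w)
    have hν : ν = μ.comp (Ad 𝓘SE g) := by
      apply ext_linearMomentum
      · rw [linearMomentum_comp_Ad, hlin, inv_inv]
      · rw [comp_Ad_apply_eΩ, hang]
    exact hν ▸ comp_Ad_mem_coadjointOrbit 𝓘SE μ g

theorem mem_cylinder_iff {ν : Model →L[ℝ] ℝ} {r : ℝ} :
    ν ∈ cylinder r ↔ Complex.normSq (linearMomentum ν) = r := by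
  rw [Complex.normSq_apply, ← sq, ← sq]
  rfl

theorem mem_axisPoint_iff {ν : Model →L[ℝ] ℝ} {c : ℝ} :
    ν ∈ axisPoint c ↔ linearMomentum ν = 0 ∧ ν eΩ = c := by
  rw [Complex.ext_iff, and_assoc]
  rfl

theorem exists_circle_mul_eq {m n : ℂ} (hm : m ≠ 0) (h : Complex.normSq n = Complex.normSq m) :
    ∃ z : Circle, n = z * m := by
  have hz : n / m ∈ Submonoid.unitSphere ℂ := by
    refine mem_sphere_zero_iff_norm.2 ((sq_eq_sq₀ (norm_nonneg _) zero_le_one).1 ?_)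
    rw [Complex.sq_norm, Complex.normSq_div, h, div_self (Complex.normSq_pos.2 hm).ne', one_pow]
  exact ⟨⟨n / m, hz⟩, (div_mul_cancel₀ n hm).symm⟩

theorem coadjointOrbit_eq_cylinder {μ : Model →L[ℝ] ℝ} (hμ : linearMomentum μ ≠ 0) :
    coadjointOrbit 𝓘SE SE2 μ = cylinder (Complex.normSq (linearMomentum μ)) := by
  ext ν
  rw [mem_coadjointOrbit_iff, mem_cylinder_iff]
  constructor
  · rintro ⟨z, w, hlin, -⟩
    rw [hlin, Complex.normSq_mul, Circle.normSq_coe, one_mul]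
  · intro hν
    obtain ⟨z, hz⟩ := exists_circle_mul_eq hμ hν
    have hμ' : conj (linearMomentum μ) ≠ 0 := (map_ne_zero _).2 hμ
    refine ⟨z, ((ν eΩ - μ eΩ : ℝ) : ℂ) * Complex.I / conj (linearMomentum μ), hz, ?_⟩
    simp [div_mul_cancel₀ _ hμ']

theorem coadjointOrbit_eq_axisPoint {μ : Model →L[ℝ] ℝ} (hμ : linearMomentum μ = 0) :
    coadjointOrbit 𝓘SE SE2 μ = axisPoint (μ eΩ) := by
  ext ν
  simp only [mem_coadjointOrbit_iff, mem_axisPoint_iff, hμ, map_zero, mul_zero, Complex.zero_im,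
    add_zero, exists_const]

theorem range_coadjointOrbit :
    range (coadjointOrbit 𝓘SE SE2)
      = {O | ∃ r > 0, O = cylinder r} ∪ {O | ∃ c, O = axisPoint c} := by
  ext O
  constructor
  · rintro ⟨μ, rfl⟩
    by_cases hμ : linearMomentum μ = 0
    · exact .inr ⟨_, coadjointOrbit_eq_axisPoint hμ⟩
    · exact .inl ⟨_, Complex.normSq_pos.2 hμ, coadjointOrbit_eq_cylinder hμ⟩
  · rintro (⟨r, hr, rfl⟩ | ⟨c, rfl⟩)
    · obtain ⟨μ, hμ, -⟩ := exists_linearMomentum_eq (√r : ℝ) 0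
      have hnorm : Complex.normSq (linearMomentum μ) = r := by
        rw [hμ, Complex.normSq_ofReal, Real.mul_self_sqrt hr.le]
      have hμ0 : linearMomentum μ ≠ 0 := Complex.normSq_pos.1 (hnorm.symm ▸ hr)
      exact ⟨μ, hnorm ▸ coadjointOrbit_eq_cylinder hμ0⟩
    · obtain ⟨μ, hμ, rfl⟩ := exists_linearMomentum_eq 0 c
      exact ⟨μ, coadjointOrbit_eq_axisPoint hμ⟩

instance : ConnectedSpace SE2 := inferInstanceAs (ConnectedSpace (Circle × ℂ))

theorem symplecticLeaves_uncoupledBracket {F : Type*} [NormedAddCommGroup F] [NormedSpace ℝ F]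
    [FiniteDimensional ℝ F] {C : Type*} [TopologicalSpace C] {J : ModelWithCorners ℝ F C}
    [J.Boundaryless] {P : Type*} [TopologicalSpace P] [ChartedSpace C P] [IsManifold J ∞ P]
    [ConnectedSpace P] (Ω : SymplecticForm J P) :
    symplecticLeaves (𝓘(ℝ, Model →L[ℝ] ℝ).prod J) (uncoupledBracket 𝓘SE SE2 Ω)
      = {L | ∃ r > 0, L = cylinder r ×ˢ univ} ∪ {L | ∃ c, L = axisPoint c ×ˢ univ} := by
  rw [SymplecticLeaves.symplecticLeaves_uncoupledBracket, range_coadjointOrbit]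
  ext L
  constructor
  · rintro ⟨_, ⟨r, hr, rfl⟩ | ⟨c, rfl⟩, rfl⟩
    exacts [.inl ⟨r, hr, rfl⟩, .inr ⟨c, rfl⟩]
  · rintro (⟨r, hr, rfl⟩ | ⟨c, rfl⟩)
    exacts [⟨_, .inl ⟨r, hr, rfl⟩, rfl⟩, ⟨_, .inr ⟨c, rfl⟩, rfl⟩]

end SE2

end SymplecticLeaves

end

theorem mainTheorem8_general :
    (∀ (E : Type*) [NormedAddCommGroup E] [NormedSpace ℝ E] [FiniteDimensional ℝ E]
      (A : Type*) [TopologicalSpace A] (I : ModelWithCorners ℝ E A) [I.Boundaryless]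
      (H : Type*) [TopologicalSpace H] [ChartedSpace A H] [Group H] [LieGroup I ∞ H]
      [ConnectedSpace H]
      (F : Type*) [NormedAddCommGroup F] [NormedSpace ℝ F] [FiniteDimensional ℝ F]
      (C : Type*) [TopologicalSpace C] (J : ModelWithCorners ℝ F C) [J.Boundaryless]
      (P : Type*) [TopologicalSpace P] [ChartedSpace C P] [IsManifold J ∞ P] [ConnectedSpace P]
      (Ω : SymplecticLeaves.SymplecticForm J P) (S : E → E → H × P → ℝ),
      (∀ (ξ η : E) (x : P), S ξ η (1, x) = 0) →
      (∀ (μ : E →L[ℝ] ℝ) (x : P),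
        SymplecticLeaves.symplecticLeaf (𝓘(ℝ, E →L[ℝ] ℝ).prod J)
          (SymplecticLeaves.naturalBracket I H Ω S) (μ, x)
          = SymplecticLeaves.coadjointOrbit I H μ ×ˢ univ) ∧
      SymplecticLeaves.symplecticLeaves (𝓘(ℝ, E →L[ℝ] ℝ).prod J)
          (SymplecticLeaves.naturalBracket I H Ω S)
        = {L | ∃ μ : E →L[ℝ] ℝ, L = SymplecticLeaves.coadjointOrbit I H μ ×ˢ univ}) ∧
    range (SymplecticLeaves.coadjointOrbit SymplecticLeaves.SE2.𝓘SE SymplecticLeaves.SE2)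
      = {O | ∃ r > 0, O = SymplecticLeaves.SE2.cylinder r} ∪
        {O | ∃ c, O = SymplecticLeaves.SE2.axisPoint c} ∧
    (∀ (F : Type*) [NormedAddCommGroup F] [NormedSpace ℝ F] [FiniteDimensional ℝ F]
      (C : Type*) [TopologicalSpace C] (J : ModelWithCorners ℝ F C) [J.Boundaryless]
      (P : Type*) [TopologicalSpace P] [ChartedSpace C P] [IsManifold J ∞ P] [ConnectedSpace P]
      (Ω : SymplecticLeaves.SymplecticForm J P)
      (S : SymplecticLeaves.SE2.Model → SymplecticLeaves.SE2.Model →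
        SymplecticLeaves.SE2 × P → ℝ),
      (∀ ξ η x, S ξ η (1, x) = 0) →
      SymplecticLeaves.symplecticLeaves (𝓘(ℝ, SymplecticLeaves.SE2.Model →L[ℝ] ℝ).prod J)
          (SymplecticLeaves.naturalBracket SymplecticLeaves.SE2.𝓘SE SymplecticLeaves.SE2 Ω S)
        = {L | ∃ r > 0, L = SymplecticLeaves.SE2.cylinder r ×ˢ univ} ∪
          {L | ∃ c, L = SymplecticLeaves.SE2.axisPoint c ×ˢ univ}) := by
  refine ⟨?_, SymplecticLeaves.SE2.range_coadjointOrbit, ?_⟩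
  · intro E _ _ _ A _ I _ H _ _ _ _ _ F _ _ _ C _ J _ P _ _ _ _ Ω S hS
    rw [SymplecticLeaves.naturalBracket_eq_uncoupledBracket I Ω hS,
      SymplecticLeaves.symplecticLeaves_uncoupledBracket, ← range_comp]
    exact ⟨SymplecticLeaves.symplecticLeaf_uncoupledBracket I H Ω,
      Set.ext fun L => exists_congr fun μ => eq_comm⟩
  · intro F _ _ _ C _ J _ P _ _ _ _ Ω S hS
    rw [SymplecticLeaves.naturalBracket_eq_uncoupledBracket SymplecticLeaves.SE2.𝓘SE Ω hS,
      SymplecticLeaves.SE2.symplecticLeaves_uncoupledBracket]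

theorem mainTheorem8 :
    -- the general case
    (∀ (E : Type*) [NormedAddCommGroup E] [NormedSpace ℝ E] [FiniteDimensional ℝ E]
      (A : Type*) [TopologicalSpace A] (I : ModelWithCorners ℝ E A) [I.Boundaryless]
      (H : Type*) [TopologicalSpace H] [ChartedSpace A H] [Group H] [LieGroup I ∞ H]
      [T2Space H] [SecondCountableTopology H] [ConnectedSpace H]
      (F : Type*) [NormedAddCommGroup F] [NormedSpace ℝ F] [FiniteDimensional ℝ F]
      (C : Type*) [TopologicalSpace C] (J : ModelWithCorners ℝ F C) [J.Boundaryless]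
      (P : Type*) [TopologicalSpace P] [ChartedSpace C P] [IsManifold J ∞ P]
      [T2Space P] [SecondCountableTopology P] [ConnectedSpace P]
      [MulAction H P] [ContMDiffSMul I J ∞ H P]
      (Ω : SymplecticLeaves.SymplecticForm J P)
      (D : SymplecticLeaves.MagneticCoupling (I := I) H Ω),
      (∀ (ξ η : E) (p : H × P), D.cocycle ξ η p = 0) →
      (∀ (μ : E →L[ℝ] ℝ) (x : P),
        SymplecticLeaves.symplecticLeaf (𝓘(ℝ, E →L[ℝ] ℝ).prod J)
          (SymplecticLeaves.naturalBracket I H Ω D.cocycle) (μ, x)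
          = SymplecticLeaves.coadjointOrbit I H μ ×ˢ univ) ∧
      SymplecticLeaves.symplecticLeaves (𝓘(ℝ, E →L[ℝ] ℝ).prod J)
          (SymplecticLeaves.naturalBracket I H Ω D.cocycle)
        = {L | ∃ μ : E →L[ℝ] ℝ, L = SymplecticLeaves.coadjointOrbit I H μ ×ˢ univ}) ∧
    -- the coadjoint orbits of `SE(2)`
    range (SymplecticLeaves.coadjointOrbit SymplecticLeaves.SE2.𝓘SE SymplecticLeaves.SE2)
      = {O | ∃ r > 0, O = SymplecticLeaves.SE2.cylinder r} ∪
        {O | ∃ c, O = SymplecticLeaves.SE2.axisPoint c} ∧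
    -- the symplectic leaves for `SE(2)` and `ℝ^{2N}`
    (∀ (N : ℕ) (Γ : Fin N → ℝ) (hΓ : ∀ i, Γ i ≠ 0),
      SymplecticLeaves.symplecticLeaves
          (𝓘(ℝ, SymplecticLeaves.SE2.Model →L[ℝ] ℝ).prod 𝓘(ℝ, Fin N → ℂ))
          (SymplecticLeaves.naturalBracket SymplecticLeaves.SE2.𝓘SE SymplecticLeaves.SE2
            (SymplecticLeaves.vortexForm Γ hΓ) (fun _ _ _ => 0))
        = {L | ∃ r > 0, L = SymplecticLeaves.SE2.cylinder r ×ˢ univ} ∪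
          {L | ∃ c, L = SymplecticLeaves.SE2.axisPoint c ×ˢ univ}) := by
  have h := mainTheorem8_general
  exact ⟨fun E _ _ _ A _ I _ H _ _ _ _ _ _ _ F _ _ _ C _ J _ P _ _ _ _ _ _ _ _ Ω D hD =>
      h.1 E A I H F C J P Ω D.cocycle fun ξ η x => hD ξ η (1, x),
    h.2.1, fun N Γ hΓ => h.2.2 _ _ _ _ (SymplecticLeaves.vortexForm Γ hΓ) _ fun _ _ _ => rfl⟩
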